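/- Let $n\ge 1$, let $\sigma_1,\sigma_2,L>0$, and let $x_1^*\neq x_2^*$ be points of $\mathbb{R}^n$ (with the Euclidean norm and inner product). For $c\in\mathbb{R}^n$ and $\sigma>0$ let $\mathcal{S}(c,\sigma)$ be the set of all differentiable $f:\mathbb{R}^n\to\mathbb{R}$ that have their minimizer at $c$ and satisfy $\langle\nabla f(x)-\nabla f(y),x-y\rangle\ge\sigma\|x-y\|^2$ for all $x,y\in\mathbb{R}^n$. The potential solution region is $$\mathcal{M}=\{x\in\mathbb{R}^n:\ \exists f_1\in\mathcal{S}(x_1^*,\sigma_1),\ \exists f_2\in\mathcal{S}(x_2^*,\sigma_2),\ \nabla f_1(x)=-\nabla f_2(x),\ \|\nabla f_1(x)\|=\|\nabla f_2(x)\|\le L\}.$$ Let $\mathcal{B}_i$ be the open ball with centre $x_i^*$ and radius $L/\sigma_i$, and let $\mathcal{D}=(\overline{\mathcal{B}}_1\cap\overline{\mathcal{B}}_2)\setminus\{x_1^*,x_2^*\}$. For $x\in\mathcal{D}$ put $\tilde\phi_i(x)=\arccos\big(\tfrac{\sigma_i}{L}\|x-x_i^*\|\big)$, let $\alpha_i(x)\in[0,\pi]$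 be the angle between $x-x_i^*$ and $x_2^*-x_1^*$, and put $\psi(x)=\pi-(\alpha_2(x)-\alpha_1(x))$. Let $\mathcal{X}=\{x:\|x-x_i^*\|=L/\sigma_i \text{ for } i=1,2\}$ if $\|x_2^*-x_1^*\|=L(\frac1{\sigma_1}+\frac1{\sigma_2})$, and $\mathcal{X}=\emptyset$ otherwise. The outer and inner approximations of $\mathcal{M}$ are $$\mathcal{M}^{\uparrow}=\{x\in\mathcal{D}:\tilde\phi_1(x)+\tilde\phi_2(x)\ge\psi(x)\},\qquad \mathcal{M}_{\downarrow}=\{x\in\mathcal{D}:\tilde\phi_1(x)+\tilde\phi_2(x)>\psi(x)\}\cup\mathcal{X}.$$ **(a)** Then $\partial\mathcal{M}=\partial\mathcal{M}^{\uparrow}=\partial\mathcal{M}_{\downarrow}$, where $\partial\mathcal{E}=\overline{\mathcal{E}}\setminus\mathcal{E}^{\circ}$. **(b)** Suppose in addition that $\sigma_1\ge\sigma_2$ and that $x_1^*=(-r,0,\dots,0)$, $x_2^*=(r,0,\dots,0)$ with $r>0$. Write $x_{(1)}$ for the first coordinate of $x$, let $\beta=\sigma_2/\sigma_1$, $\gamma_i=L^2/\sigma_i^2$,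 $d_i(x)=\|x-x_i^*\|$, $$\lambda_1=\frac{1+\beta}{1+2\beta}\cdot\frac{\gamma_1}{2r}-\frac{r}{1+2\beta},\qquad \lambda_2=-\frac{1+\beta}{2+\beta}\cdot\frac{\gamma_2}{2r}+\frac{\beta r}{2+\beta},$$ $$\mathcal{T}=\Big\{x\in\mathcal{D}:\ \frac{\|x\|^2-r^2}{d_1(x)^2d_2(x)^2}+\frac{\sigma_1\sigma_2}{L^2}=\sqrt{\tfrac1{d_1(x)^2}-\tfrac{\sigma_1^2}{L^2}}\cdot\sqrt{\tfrac1{d_2(x)^2}-\tfrac{\sigma_2^2}{L^2}}\Big\},$$ $\mathcal{K}_1=\{x\in\partial\mathcal{B}_1:x_{(1)}>\lambda_1\}$ and $\mathcal{K}_2=\{x\in\partial\mathcal{B}_2:x_{(1)}<\lambda_2\}$. Then, with $\sqcup$ denoting a union of pairwise disjoint sets, 1. if $0<r\le\frac{L}{2\sigma_1}$, then $\partial\mathcal{M}=\mathcal{T}\sqcup\{x_1^*,x_2^*\}$; 2. if $\frac{L}{2\sigma_1}<r\le\frac{L}{2\sigma_2}$, then $\partial\mathcal{M}=\mathcal{K}_1\sqcup\mathcal{T}\sqcup\{x_1^*\}$;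 3. if $\frac{L}{2\sigma_2}<r<\frac L2\big(\frac1{\sigma_1}+\frac1{\sigma_2}\big)$, then $\partial\mathcal{M}=\mathcal{K}_1\sqcup\mathcal{K}_2\sqcup\mathcal{T}$; 4. if $r=\frac L2\big(\frac1{\sigma_1}+\frac1{\sigma_2}\big)$, then $\mathcal{M}=\big\{\big(\frac L2(\frac1{\sigma_1}-\frac1{\sigma_2}),0,\dots,0\big)\big\}$; 5. if $r>\frac L2\big(\frac1{\sigma_1}+\frac1{\sigma_2}\big)$, then $\mathcal{M}=\emptyset$. -/

import Mathlib

noncomputable section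

namespace PotentialRegion

/-- Euclidean `n`-space. -/
abbrev E (n : ℕ) : Type := EuclideanSpace ℝ (Fin n)

/-- The differentiable, `σ`-strongly convex functions on Euclidean space that have their
minimizer at `c`; strong convexity is strong monotonicity of the gradient. -/
def stronglyConvexClass {n : ℕ} (c : E n) (σ : ℝ) : Set (E n → ℝ) :=
  {f | Differentiable ℝ f ∧
    (∀ x y : E n, σ * ‖x - y‖ ^ 2 ≤ inner ℝ (gradient f x - gradient f y) (x - y)) ∧
    ∀ y : E n, f c ≤ f y}

/-- The potential solution region: the points at which the gradients of an admissible pair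
`f₁, f₂` cancel and have norm at most `L`. -/
def solutionRegion {n : ℕ} (c₁ c₂ : E n) (σ₁ σ₂ L : ℝ) : Set (E n) :=
  {x | ∃ f₁ ∈ stronglyConvexClass c₁ σ₁, ∃ f₂ ∈ stronglyConvexClass c₂ σ₂,
    gradient f₁ x = -gradient f₂ x ∧
    ‖gradient f₁ x‖ = ‖gradient f₂ x‖ ∧ ‖gradient f₂ x‖ ≤ L}

/-- The angle `arccos ((σ / L) ‖x - c‖)`, meaningful on the closed ball of radius `L / σ`
around `c`. -/
def phiTilde {n : ℕ} (c : E n) (σ L : ℝ) (x : E n) : ℝ :=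
  Real.arccos (σ / L * ‖x - c‖)

/-- The angle between `x - c` and `c₂ - c₁`, meaningful for `x ≠ c` and `c₁ ≠ c₂`. It is used
with `c = c₁` and `c = c₂`. -/
def alpha {n : ℕ} (c₁ c₂ c x : E n) : ℝ :=
  InnerProductGeometry.angle (x - c) (c₂ - c₁)

/-- The angle `π - (α₂ - α₁)`. -/
def psi {n : ℕ} (c₁ c₂ x : E n) : ℝ :=
  Real.pi - (alpha c₁ c₂ c₂ x - alpha c₁ c₂ c₁ x)

/-- The common domain of the angle functions: the intersection of the closed balls of radius
`L / σᵢ` around `cᵢ`, without the two centres. -/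
def angleDomain {n : ℕ} (c₁ c₂ : E n) (σ₁ σ₂ L : ℝ) : Set (E n) :=
  (Metric.closedBall c₁ (L / σ₁) ∩ Metric.closedBall c₂ (L / σ₂)) \ {c₁, c₂}

/-- The exceptional set: the common points of the two spheres when these are externally
tangent, and empty otherwise. -/
def tangencySet {n : ℕ} (c₁ c₂ : E n) (σ₁ σ₂ L : ℝ) : Set (E n) :=
  {x | ‖c₂ - c₁‖ = L * (1 / σ₁ + 1 / σ₂) ∧ ‖x - c₁‖ = L / σ₁ ∧ ‖x - c₂‖ = L / σ₂}

/-- The outer approximation. -/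
def outerRegion {n : ℕ} (c₁ c₂ : E n) (σ₁ σ₂ L : ℝ) : Set (E n) :=
  {x | x ∈ angleDomain c₁ c₂ σ₁ σ₂ L ∧
    psi c₁ c₂ x ≤ phiTilde c₁ σ₁ L x + phiTilde c₂ σ₂ L x}

/-- The inner approximation. -/
def innerRegion {n : ℕ} (c₁ c₂ : E n) (σ₁ σ₂ L : ℝ) : Set (E n) :=
  {x | x ∈ angleDomain c₁ c₂ σ₁ σ₂ L ∧
    psi c₁ c₂ x < phiTilde c₁ σ₁ L x + phiTilde c₂ σ₂ L x} ∪
  tangencySet c₁ c₂ σ₁ σ₂ L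

/-- The point `(t, 0, …, 0)`. -/
def axisPoint (n : ℕ) [NeZero n] (t : ℝ) : E n := EuclideanSpace.single 0 t

/-- The algebraic curve (hypersurface) `𝒯`, for the centres `(-r, 0, …, 0)` and
`(r, 0, …, 0)`, restricted to the points where its defining equation is meaningful. -/
def curveT (n : ℕ) [NeZero n] (r σ₁ σ₂ L : ℝ) : Set (E n) :=
  {x | x ∈ angleDomain (axisPoint n (-r)) (axisPoint n r) σ₁ σ₂ L ∧
    (‖x‖ ^ 2 - r ^ 2) / (‖x - axisPoint n (-r)‖ ^ 2 * ‖x - axisPoint n r‖ ^ 2)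
        + σ₁ * σ₂ / L ^ 2 =
      Real.sqrt (1 / ‖x - axisPoint n (-r)‖ ^ 2 - σ₁ ^ 2 / L ^ 2) *
        Real.sqrt (1 / ‖x - axisPoint n r‖ ^ 2 - σ₂ ^ 2 / L ^ 2)}

/-- `λ₁`, with `β = σ₂ / σ₁` and `γ₁ = L² / σ₁²`. -/
def lambda₁ (r σ₁ σ₂ L : ℝ) : ℝ :=
  (1 + σ₂ / σ₁) / (1 + 2 * (σ₂ / σ₁)) * ((L ^ 2 / σ₁ ^ 2) / (2 * r))
    - r / (1 + 2 * (σ₂ / σ₁))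

/-- `λ₂`, with `β = σ₂ / σ₁` and `γ₂ = L² / σ₂²`. -/
def lambda₂ (r σ₁ σ₂ L : ℝ) : ℝ :=
  -((1 + σ₂ / σ₁) / (2 + σ₂ / σ₁)) * ((L ^ 2 / σ₂ ^ 2) / (2 * r))
    + (σ₂ / σ₁) * r / (2 + σ₂ / σ₁)

/-- `∂ℬ₁ ∩ (ℋ₁⁻)ᶜ`: the part of the sphere of radius `L / σ₁` around `(-r, 0, …, 0)` that does
not lie in the half-space `x₁ ≤ λ₁`. -/
def cap₁ (n : ℕ) [NeZero n] (r σ₁ σ₂ L : ℝ) : Set (E n) :=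
  frontier (Metric.ball (axisPoint n (-r)) (L / σ₁)) ∩ {x | x 0 ≤ lambda₁ r σ₁ σ₂ L}ᶜ

/-- `∂ℬ₂ ∩ (ℋ₂⁺)ᶜ`: the part of the sphere of radius `L / σ₂` around `(r, 0, …, 0)` that does
not lie in the half-space `x₁ ≥ λ₂`. -/
def cap₂ (n : ℕ) [NeZero n] (r σ₁ σ₂ L : ℝ) : Set (E n) :=
  frontier (Metric.ball (axisPoint n r) (L / σ₂)) ∩ {x | lambda₂ r σ₁ σ₂ L ≤ x 0}ᶜ

end PotentialRegion

end

/-! A gradient `u` at `x` of a function in the class of `c` satisfies `σ‖x - c‖² ≤ ⟪u, x - c⟫`; if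
also `‖u‖ ≤ L`, then `u` makes an angle at most `phiTilde c σ L x` with `x - c`. Conversely, a
vector satisfying this strictly, or equal to `σ • (x - c)`, is the gradient of an explicit quadratic
(`exists_gradient_eq`). So `x` lies in the region when one vector is close enough in angle both to
`x - c₁` and to `c₂ - x`. The angle between these two is `psi`, so the triangle inequality for
angles gives the outer bound, and rotating a vector from one to the other gives the inner one.

Everything is then read off from `angleGap`, i.e. `φ₁ + φ₂ - ψ`. Off the segment joining the centres
it strictly decreases along the ray leaving the nearest point of the segment (`angleGap_ray_lt`). On
the segment `ψ = 0`, so the gap is positive except at a tangency point. Hence the outer set lies in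
the closure of the inner one, its interior lies in the inner one, and every set in between has the
same frontier.

For (b), that frontier consists of sphere points with positive gap, points with zero gap, and those
centres that are limits. On a sphere one `φᵢ` vanishes and positivity of the gap becomes linear in
the first coordinate, which gives the caps; taking cosines in `φ₁ + φ₂ = ψ` gives the equation of
`curveT`. -/

namespace PotentialRegion

open InnerProductGeometry

/-! ### Angles between vectors in an inner product space -/

section Angles

variable {V : Type*} [NormedAddCommGroup V] [InnerProductSpace ℝ V]

/-- Moving a nonzero vector away from `q` does not decrease its angle with `q`. -/
theorem angle_le_angle_smul_sub_smul {p q : V} {a b : ℝ} (ha : 0 < a) (hb : 0 ≤ b)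
    (hp : p ≠ 0) (h : a • p - b • q ≠ 0) : angle p q ≤ angle (a • p - b • q) q := by
  rcases eq_or_ne q 0 with rfl | hq
  · simp
  set p' := a • p - b • q with hp'
  rw [← angle_smul_left_of_pos p q ha]
  have hap : a • p = p' + b • q := by simp [hp']
  have hap0 : a • p ≠ 0 := smul_ne_zero ha.ne' hp
  have h0 : 0 < ‖a • p‖ := norm_pos_iff.2 hap0
  have h1 : 0 < ‖p'‖ := norm_pos_iff.2 h
  have h2 : 0 < ‖q‖ := norm_pos_iff.2 hq
  unfold angle
  apply Real.arccos_le_arccos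
  rw [div_le_div_iff₀ (by positivity) (by positivity)]
  have e : inner ℝ (a • p) q = inner ℝ p' q + b * ‖q‖ ^ 2 := by
    rw [hap, inner_add_left, real_inner_smul_left, real_inner_self_eq_norm_sq]
  -- The comparison of cosines reduces to `k3`, the product of the reverse triangle inequality and
  -- Cauchy–Schwarz.
  have k1 : |‖a • p‖ - ‖p'‖| ≤ b * ‖q‖ := by
    have := abs_norm_sub_norm_le (a • p) p'
    rwa [hap, add_sub_cancel_left, norm_smul, Real.norm_of_nonneg hb, ← hap] at this
  have k2 : |inner ℝ p' q| ≤ ‖p'‖ * ‖q‖ := abs_real_inner_le_norm p' q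
  have k3 : (‖a • p‖ - ‖p'‖) * inner ℝ p' q ≤ (b * ‖q‖) * (‖p'‖ * ‖q‖) := by
    refine (le_abs_self _).trans ?_
    rw [abs_mul]
    gcongr
  rw [e]
  have k4 : inner ℝ p' q * ‖a • p‖ ≤ (inner ℝ p' q + b * ‖q‖ ^ 2) * ‖p'‖ := by
    linarith [k3]
  calc inner ℝ p' q * (‖a • p‖ * ‖q‖) = (inner ℝ p' q * ‖a • p‖) * ‖q‖ := by ring
    _ ≤ ((inner ℝ p' q + b * ‖q‖ ^ 2) * ‖p'‖) * ‖q‖ := by gcongr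
    _ = _ := by ring

/-- Spherical interpolation: a unit vector at prescribed angles to two given vectors. -/
theorem exists_unit_inner_eq {p q : V} (hp : p ≠ 0) (hq : q ≠ 0) (hpq : angle p q < Real.pi)
    {t : ℝ} (ht : 0 ≤ t) (ht' : t ≤ angle p q) :
    ∃ u : V, ‖u‖ = 1 ∧ inner ℝ u p = ‖p‖ * Real.cos t ∧
      inner ℝ u q = ‖q‖ * Real.cos (angle p q - t) := by
  have hp0 : 0 < ‖p‖ := norm_pos_iff.2 hp
  have hq0 : 0 < ‖q‖ := norm_pos_iff.2 hq
  rcases (angle_nonneg p q).eq_or_lt with h0 | h0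
  · have ht0 : t = 0 := by linarith
    subst ht0
    obtain ⟨-, r, hr, rfl⟩ := angle_eq_zero_iff.1 h0.symm
    refine ⟨‖p‖⁻¹ • p, ?_, ?_, ?_⟩
    · rw [norm_smul, norm_inv, norm_norm, inv_mul_cancel₀ hp0.ne']
    · rw [real_inner_smul_left, real_inner_self_eq_norm_sq, Real.cos_zero]
      field_simp
    · rw [real_inner_smul_left, real_inner_smul_right, real_inner_self_eq_norm_sq, ← h0,
        norm_smul, Real.norm_of_nonneg hr.le]
      simp
      field_simp
  · set ψ := angle p q with hψ
    have hs : 0 < Real.sin ψ := Real.sin_pos_of_pos_of_lt_pi h0 hpq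
    -- Spherical linear interpolation coefficients; the case of parallel vectors was split off
    -- because `sin ψ` would vanish.
    set A := Real.sin (ψ - t) / Real.sin ψ with hA
    set B := Real.sin t / Real.sin ψ with hB
    have hip : inner ℝ p q = Real.cos ψ * (‖p‖ * ‖q‖) := (cos_angle_mul_norm_mul_norm p q).symm
    have e1 : A + B * Real.cos ψ = Real.cos t := by
      rw [hA, hB, Real.sin_sub]; field_simp; ring
    have e2 : A * Real.cos ψ + B = Real.cos (ψ - t) := by
      rw [hA, hB, Real.sin_sub, Real.cos_sub]; field_simp
      linear_combination (-Real.sin t) * Real.sin_sq_add_cos_sq ψ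
    have e3 : A * Real.cos t + B * Real.cos (ψ - t) = 1 := by
      have := Real.sin_add (ψ - t) t
      rw [sub_add_cancel] at this
      rw [hA, hB]; field_simp; linarith
    set u : V := (A / ‖p‖) • p + (B / ‖q‖) • q with hu
    have i1 : inner ℝ u p = ‖p‖ * Real.cos t := by
      rw [hu, inner_add_left, real_inner_smul_left, real_inner_smul_left,
        real_inner_self_eq_norm_sq, real_inner_comm, hip, ← e1]
      field_simp
    have i2 : inner ℝ u q = ‖q‖ * Real.cos (ψ - t) := by
      rw [hu, inner_add_left, real_inner_smul_left, real_inner_smul_left,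
        real_inner_self_eq_norm_sq, hip, ← e2]
      field_simp
    refine ⟨u, ?_, i1, i2⟩
    have : ‖u‖ ^ 2 = 1 := by
      rw [← real_inner_self_eq_norm_sq]
      nth_rw 2 [hu]
      rw [inner_add_right, real_inner_smul_right, real_inner_smul_right, i1, i2, ← e3]
      field_simp
    exact (pow_eq_one_iff_of_nonneg (norm_nonneg u) two_ne_zero).1 this

end Angles

/-! ### Gradients realised by strongly convex functions -/

section ConvexClass

variable {n : ℕ}

theorem gradient_center_eq_zero {c : E n} {σ : ℝ} {f : E n → ℝ}
    (hf : f ∈ stronglyConvexClass c σ) : gradient f c = 0 := by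
  have : fderiv ℝ f c = 0 :=
    IsLocalMin.fderiv_eq_zero (Filter.Eventually.of_forall hf.2.2)
  simp [gradient, this]

theorem norm_sub_sq_le_inner_gradient {c x : E n} {σ : ℝ} {f : E n → ℝ}
    (hf : f ∈ stronglyConvexClass c σ) : σ * ‖x - c‖ ^ 2 ≤ inner ℝ (gradient f x) (x - c) := by
  simpa [gradient_center_eq_zero hf] using hf.2.1 x c

theorem hasGradientAt_quadratic (c v : E n) (σ k : ℝ) (x : E n) :
    HasGradientAt (fun y => σ / 2 * ‖y - c‖ ^ 2 + k / 2 * inner ℝ v (y - c) ^ 2)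
      (σ • (x - c) + (k * inner ℝ v (x - c)) • v) x := by
  rw [hasGradientAt_iff_hasFDerivAt]
  have h1 : HasFDerivAt (fun y : E n => y - c) (ContinuousLinearMap.id ℝ (E n)) x :=
    (hasFDerivAt_id x).sub_const c
  have h2 := (h1.norm_sq).const_mul (σ / 2)
  have h3 := (((innerSL ℝ v).hasFDerivAt.comp x h1).pow 2).const_mul (k / 2)
  refine (h2.add h3).congr_fderiv ?_
  ext y
  simp
  ring

theorem quadratic_mem_stronglyConvexClass (c v : E n) {σ k : ℝ} (hσ : 0 < σ) (hk : 0 ≤ k) :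
    (fun y => σ / 2 * ‖y - c‖ ^ 2 + k / 2 * inner ℝ v (y - c) ^ 2) ∈
      stronglyConvexClass c σ := by
  refine ⟨fun x => (hasGradientAt_quadratic c v σ k x).differentiableAt, fun x y => ?_,
    fun y => ?_⟩
  · rw [(hasGradientAt_quadratic c v σ k x).gradient, (hasGradientAt_quadratic c v σ k y).gradient]
    have e : σ • (x - c) + (k * inner ℝ v (x - c)) • v -
        (σ • (y - c) + (k * inner ℝ v (y - c)) • v) =
        σ • (x - y) + (k * inner ℝ v (x - y)) • v := by
      have : inner ℝ v (x - y) = inner ℝ v (x - c) - inner ℝ v (y - c) := by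
        rw [← inner_sub_right]; congr 1; abel
      rw [this]; module
    rw [e, inner_add_left, real_inner_smul_left, real_inner_smul_left, real_inner_self_eq_norm_sq]
    nlinarith [mul_nonneg hk (sq_nonneg (inner ℝ v (x - y)))]
  · simp only [sub_self, norm_zero, inner_zero_right]
    have : 0 ≤ σ / 2 * ‖y - c‖ ^ 2 + k / 2 * inner ℝ v (y - c) ^ 2 := by positivity
    simpa using this

/-- Which vectors occur as gradients at `x` of functions in the class. -/
theorem exists_gradient_eq {c x u : E n} {σ : ℝ} (hσ : 0 < σ)
    (h : σ * ‖x - c‖ ^ 2 < inner ℝ u (x - c) ∨ u = σ • (x - c)) :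
    ∃ f ∈ stronglyConvexClass c σ, gradient f x = u := by
  rcases h with h | rfl
  -- The rank-one term with weight `k = 1 / ⟪v, x - c⟫` has gradient exactly `v` at `x`; strictness
  -- in `h` makes this weight positive.
  · set v := u - σ • (x - c) with hv
    have hs : 0 < inner ℝ v (x - c) := by
      rw [hv, inner_sub_left, real_inner_smul_left, real_inner_self_eq_norm_sq]; linarith
    refine ⟨_, quadratic_mem_stronglyConvexClass c v hσ (inv_nonneg.2 hs.le), ?_⟩
    rw [(hasGradientAt_quadratic c v σ _ x).gradient, inv_mul_cancel₀ hs.ne', one_smul, hv]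
    abel
  · refine ⟨_, quadratic_mem_stronglyConvexClass c 0 hσ le_rfl, ?_⟩
    rw [(hasGradientAt_quadratic c 0 σ _ x).gradient]
    simp

end ConvexClass

end PotentialRegion

namespace PotentialRegion

open InnerProductGeometry

/-! ### The inclusions inner ⊆ solution ⊆ outer -/

section Regions

variable {n : ℕ} {c c₁ c₂ x : E n} {σ σ₁ σ₂ L : ℝ}

/-- The excess `φ₁ + φ₂ - ψ`, whose sign decides membership in the approximations. -/
noncomputable def angleGap (c₁ c₂ : E n) (σ₁ σ₂ L : ℝ) (x : E n) : ℝ :=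
  phiTilde c₁ σ₁ L x + phiTilde c₂ σ₂ L x - psi c₁ c₂ x

theorem mem_angleDomain_iff : x ∈ angleDomain c₁ c₂ σ₁ σ₂ L ↔
    (‖x - c₁‖ ≤ L / σ₁ ∧ ‖x - c₂‖ ≤ L / σ₂) ∧ x ≠ c₁ ∧ x ≠ c₂ := by
  simp [angleDomain, dist_eq_norm]

theorem mem_outerRegion_iff : x ∈ outerRegion c₁ c₂ σ₁ σ₂ L ↔
    x ∈ angleDomain c₁ c₂ σ₁ σ₂ L ∧ 0 ≤ angleGap c₁ c₂ σ₁ σ₂ L x := by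
  simp [outerRegion, angleGap]

theorem mem_innerRegion_iff : x ∈ innerRegion c₁ c₂ σ₁ σ₂ L ↔
    (x ∈ angleDomain c₁ c₂ σ₁ σ₂ L ∧ 0 < angleGap c₁ c₂ σ₁ σ₂ L x) ∨
      x ∈ tangencySet c₁ c₂ σ₁ σ₂ L := by
  simp [innerRegion, angleGap]

/-- The angle sum of the triangle `c₁ x c₂` makes `psi` its exterior angle at `x`. With the default
angle `π / 2` for zero vectors this also covers `x` at a centre. -/
theorem psi_eq_angle (hc : c₁ ≠ c₂) :
    psi c₁ c₂ x = angle (x - c₁) (c₂ - x) := by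
  have h := EuclideanGeometry.angle_add_angle_add_angle_eq_pi x hc
  simp only [EuclideanGeometry.angle, vsub_eq_sub] at h
  unfold psi alpha
  rw [← neg_sub x c₂, ← neg_sub c₂ c₁, angle_neg_right, angle_comm (c₂ - c₁)] at h
  rw [← neg_sub x c₂, angle_neg_right]
  rw [← neg_sub x c₁, angle_neg_right, angle_neg_left] at h
  linarith

theorem psi_comm (hc : c₁ ≠ c₂) : psi c₂ c₁ x = psi c₁ c₂ x := by
  rw [psi_eq_angle hc, psi_eq_angle hc.symm, ← angle_neg_neg, neg_sub, neg_sub, angle_comm]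

theorem angleGap_comm (hc : c₁ ≠ c₂) :
    angleGap c₂ c₁ σ₂ σ₁ L x = angleGap c₁ c₂ σ₁ σ₂ L x := by
  unfold angleGap
  rw [psi_comm hc, add_comm (phiTilde c₂ σ₂ L x)]

section Phi

theorem ratio_nonneg (hσ : 0 < σ) (hL : 0 < L) (x c : E n) : 0 ≤ σ / L * ‖x - c‖ := by
  positivity

theorem ratio_le_one_iff (hσ : 0 < σ) (hL : 0 < L) : σ / L * ‖x - c‖ ≤ 1 ↔ ‖x - c‖ ≤ L / σ := by
  rw [div_mul_eq_mul_div, div_le_one hL, le_div_iff₀' hσ]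

theorem ratio_lt_one_iff (hσ : 0 < σ) (hL : 0 < L) : σ / L * ‖x - c‖ < 1 ↔ ‖x - c‖ < L / σ := by
  rw [div_mul_eq_mul_div, div_lt_one hL, lt_div_iff₀' hσ]

theorem cos_phiTilde (hσ : 0 < σ) (hL : 0 < L) (h : ‖x - c‖ ≤ L / σ) :
    Real.cos (phiTilde c σ L x) = σ / L * ‖x - c‖ :=
  Real.cos_arccos (by linarith [ratio_nonneg hσ hL x c]) ((ratio_le_one_iff hσ hL).2 h)

theorem phiTilde_nonneg : 0 ≤ phiTilde c σ L x := Real.arccos_nonneg _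

theorem phiTilde_lt_pi_div_two (hσ : 0 < σ) (hL : 0 < L) (hx : x ≠ c) :
    phiTilde c σ L x < Real.pi / 2 := by
  have : 0 < ‖x - c‖ := norm_pos_iff.2 (sub_ne_zero.2 hx)
  exact Real.arccos_lt_pi_div_two.2 (by positivity)

theorem phiTilde_pos_iff (hσ : 0 < σ) (hL : 0 < L) :
    0 < phiTilde c σ L x ↔ ‖x - c‖ < L / σ := by
  rw [phiTilde, Real.arccos_pos, ratio_lt_one_iff hσ hL]

theorem phiTilde_eq_zero (hσ : 0 < σ) (hL : 0 < L) (h : ‖x - c‖ = L / σ) :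
    phiTilde c σ L x = 0 := by
  rw [phiTilde, h, div_mul_div_cancel₀ hL.ne', div_self hσ.ne', Real.arccos_one]

theorem phiTilde_lt_phiTilde (hσ : 0 < σ) (hL : 0 < L) {y : E n} (h : ‖y - c‖ ≤ L / σ)
    (hxy : ‖x - c‖ < ‖y - c‖) : phiTilde c σ L y < phiTilde c σ L x :=
  Real.arccos_lt_arccos (by linarith [ratio_nonneg hσ hL x c]) (by gcongr)
    ((ratio_le_one_iff hσ hL).2 h)

/-- The cosine of the angle is at least `σ‖x - c‖ / ‖u‖`, hence at least `σ‖x - c‖ / L`;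
Cauchy–Schwarz bounds the distance. -/
theorem angle_le_phiTilde (hσ : 0 < σ) (hL : 0 < L) {u : E n} (hu : ‖u‖ ≤ L) (hx : x ≠ c)
    (h : σ * ‖x - c‖ ^ 2 ≤ inner ℝ u (x - c)) :
    ‖x - c‖ ≤ L / σ ∧ angle u (x - c) ≤ phiTilde c σ L x := by
  have hd : 0 < ‖x - c‖ := norm_pos_iff.2 (sub_ne_zero.2 hx)
  have hcs := real_inner_le_norm u (x - c)
  have hpos : 0 < inner ℝ u (x - c) := lt_of_lt_of_le (by positivity) h
  have hu0 : 0 < ‖u‖ := by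
    by_contra hh
    have : ‖u‖ = 0 := le_antisymm (not_lt.1 hh) (norm_nonneg u)
    rw [this, zero_mul] at hcs
    linarith
  have h1 : σ * ‖x - c‖ ≤ ‖u‖ := by
    have : (σ * ‖x - c‖) * ‖x - c‖ ≤ ‖u‖ * ‖x - c‖ := by nlinarith
    exact le_of_mul_le_mul_right this hd
  refine ⟨(le_div_iff₀' hσ).2 (h1.trans hu), Real.arccos_le_arccos ?_⟩
  rw [div_mul_eq_mul_div, div_le_div_iff₀ hL (by positivity)]
  calc σ * ‖x - c‖ * (‖u‖ * ‖x - c‖) = (σ * ‖x - c‖ ^ 2) * ‖u‖ := by ring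
    _ ≤ inner ℝ u (x - c) * L := by gcongr

end Phi

theorem solutionRegion_subset_outerRegion (hc : c₁ ≠ c₂) (hσ₁ : 0 < σ₁) (hσ₂ : 0 < σ₂)
    (hL : 0 < L) : solutionRegion c₁ c₂ σ₁ σ₂ L ⊆ outerRegion c₁ c₂ σ₁ σ₂ L := by
  rintro x ⟨f₁, hf₁, f₂, hf₂, h, hn, hle⟩
  have i1 := norm_sub_sq_le_inner_gradient (x := x) hf₁
  have i2 := norm_sub_sq_le_inner_gradient (x := x) hf₂
  have hx1 : x ≠ c₁ := by
    rintro rfl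
    rw [gradient_center_eq_zero hf₁, zero_eq_neg] at h
    rw [h, inner_zero_left] at i2
    have : 0 < ‖x - c₂‖ := norm_pos_iff.2 (sub_ne_zero.2 hc)
    have : 0 < σ₂ * ‖x - c₂‖ ^ 2 := by positivity
    linarith
  have hx2 : x ≠ c₂ := by
    rintro rfl
    rw [gradient_center_eq_zero hf₂, neg_zero] at h
    rw [h, inner_zero_left] at i1
    have : 0 < ‖x - c₁‖ := norm_pos_iff.2 (sub_ne_zero.2 hc.symm)
    have : 0 < σ₁ * ‖x - c₁‖ ^ 2 := by positivity
    linarith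
  obtain ⟨d1, a1⟩ := angle_le_phiTilde hσ₁ hL (hn ▸ hle) hx1 i1
  obtain ⟨d2, a2⟩ := angle_le_phiTilde hσ₂ hL hle hx2 i2
  refine mem_outerRegion_iff.2 ⟨mem_angleDomain_iff.2 ⟨⟨d1, d2⟩, hx1, hx2⟩, ?_⟩
  -- The common gradient direction is the intermediate vector in the triangle inequality for angles.
  have t := angle_le_angle_add_angle (x - c₁) (gradient f₁ x) (c₂ - x)
  have e : angle (gradient f₁ x) (c₂ - x) = angle (gradient f₂ x) (x - c₂) := by
    rw [h, ← neg_sub x c₂, angle_neg_neg]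
  rw [e, angle_comm (x - c₁) (gradient f₁ x)] at t
  rw [angleGap, psi_eq_angle hc]
  linarith

theorem angle_lt_pi_of_angleGap_nonneg (hc : c₁ ≠ c₂) (hσ₁ : 0 < σ₁) (hσ₂ : 0 < σ₂)
    (hL : 0 < L) (h₁ : x ≠ c₁) (h₂ : x ≠ c₂) (h : 0 ≤ angleGap c₁ c₂ σ₁ σ₂ L x) :
    angle (x - c₁) (c₂ - x) < Real.pi := by
  rw [angleGap, psi_eq_angle hc] at h
  linarith [phiTilde_lt_pi_div_two hσ₁ hL h₁, phiTilde_lt_pi_div_two hσ₂ hL h₂]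

theorem innerRegion_subset_solutionRegion (hc : c₁ ≠ c₂) (hσ₁ : 0 < σ₁) (hσ₂ : 0 < σ₂)
    (hL : 0 < L) : innerRegion c₁ c₂ σ₁ σ₂ L ⊆ solutionRegion c₁ c₂ σ₁ σ₂ L := by
  intro x hx
  suffices H : ∃ u : E n, ‖u‖ ≤ L ∧
      (σ₁ * ‖x - c₁‖ ^ 2 < inner ℝ u (x - c₁) ∨ u = σ₁ • (x - c₁)) ∧
      (σ₂ * ‖x - c₂‖ ^ 2 < inner ℝ (-u) (x - c₂) ∨ -u = σ₂ • (x - c₂)) by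
    obtain ⟨u, hu, h1, h2⟩ := H
    obtain ⟨f₁, hf₁, e1⟩ := exists_gradient_eq hσ₁ h1
    obtain ⟨f₂, hf₂, e2⟩ := exists_gradient_eq hσ₂ h2
    exact ⟨f₁, hf₁, f₂, hf₂, by rw [e1, e2, neg_neg], by rw [e1, e2, norm_neg],
      by rwa [e2, norm_neg]⟩
  rcases mem_innerRegion_iff.1 hx with ⟨hD, hgap⟩ | ⟨hd, h1, h2⟩
  · obtain ⟨⟨d1, d2⟩, hx1, hx2⟩ := mem_angleDomain_iff.1 hD
    have hp : x - c₁ ≠ 0 := sub_ne_zero.2 hx1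
    have hq : c₂ - x ≠ 0 := sub_ne_zero.2 hx2.symm
    have hp0 := norm_pos_iff.2 hp
    have hq0 := norm_pos_iff.2 hq
    have hπ := angle_lt_pi_of_angleGap_nonneg hc hσ₁ hσ₂ hL hx1 hx2 hgap.le
    have hg := hgap
    rw [angleGap, psi_eq_angle hc] at hg
    set ψ := angle (x - c₁) (c₂ - x) with hψ
    have hψ0 : 0 ≤ ψ := angle_nonneg _ _
    set a := phiTilde c₁ σ₁ L x
    set b := phiTilde c₂ σ₂ L x
    have ha0 : 0 ≤ a := phiTilde_nonneg
    have hb0 : 0 ≤ b := phiTilde_nonneg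
    have ha1 : Real.cos a = σ₁ / L * ‖x - c₁‖ := cos_phiTilde hσ₁ hL d1
    have hb1 : Real.cos b = σ₂ / L * ‖x - c₂‖ := cos_phiTilde hσ₂ hL d2
    have haπ := phiTilde_lt_pi_div_two hσ₁ hL hx1
    have hbπ := phiTilde_lt_pi_div_two hσ₂ hL hx2
    have hpi := Real.pi_pos
    -- Here `t` is the rotation from `x - c₁` towards `c₂ - x`. Both bounds must be strict for a
    -- quadratic to exist, except at a zero angle, where the gradient is exactly `σ • (x - c)`. In
    -- the generic case `t` is the midpoint of the nonempty interval from `ψ - b` to `min a ψ`.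
    obtain ⟨t, ht0, htψ, hta, htb⟩ : ∃ t, 0 ≤ t ∧ t ≤ ψ ∧ (t < a ∨ t = 0 ∧ a = 0) ∧
        (ψ - t < b ∨ t = ψ ∧ b = 0) := by
      rcases ha0.eq_or_lt with ha | ha
      · exact ⟨0, le_rfl, hψ0, Or.inr ⟨rfl, ha.symm⟩, Or.inl (by linarith)⟩
      rcases hb0.eq_or_lt with hb | hb
      · exact ⟨ψ, hψ0, le_rfl, Or.inl (by linarith), Or.inr ⟨rfl, hb.symm⟩⟩
      rcases lt_or_ge ψ b with h | h
      · exact ⟨0, le_rfl, hψ0, Or.inl ha, Or.inl (by linarith)⟩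
      · exact ⟨(ψ - b + min a ψ) / 2, by
          have := le_min ha0 hψ0; linarith, by linarith [min_le_right a ψ],
          Or.inl (by
            rcases min_cases a ψ with ⟨h, h'⟩ | ⟨h, h'⟩ <;> rw [h] <;> linarith),
          Or.inl (by rcases min_cases a ψ with ⟨h, h'⟩ | ⟨h, h'⟩ <;> rw [h] <;> linarith)⟩
    obtain ⟨u, hu, i1, i2⟩ := exists_unit_inner_eq hp hq hπ ht0 htψ
    have hLu : ‖L • u‖ = L := by rw [norm_smul, hu, mul_one, Real.norm_of_nonneg hL.le]
    refine ⟨L • u, hLu.le, ?_, ?_⟩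
    · rcases hta with h | ⟨h, h'⟩
      · left
        have : σ₁ / L * ‖x - c₁‖ < Real.cos t := by
          rw [← ha1]; exact Real.cos_lt_cos_of_nonneg_of_le_pi ht0 (by linarith) h
        rw [real_inner_smul_left, i1]
        calc σ₁ * ‖x - c₁‖ ^ 2 = L * (‖x - c₁‖ * (σ₁ / L * ‖x - c₁‖)) := by field_simp
          _ < _ := by gcongr
      · right
        rw [h, Real.cos_zero, mul_one] at i1
        rw [h', Real.cos_zero] at ha1
        have : u = ‖x - c₁‖⁻¹ • (x - c₁) := by
          have := (inner_eq_norm_mul_iff_real (x := u) (y := x - c₁)).1 (by rw [i1, hu, one_mul])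
          rw [hu, one_smul] at this
          rwa [eq_inv_smul_iff₀ hp0.ne']
        rw [this, smul_smul]
        congr 1
        field_simp at ha1 ⊢
        linarith
    · rw [← neg_sub c₂ x, inner_neg_neg, norm_neg, smul_neg, neg_inj]
      rw [← norm_neg, neg_sub] at hb1
      rcases htb with h | ⟨h, h'⟩
      · left
        have : σ₂ / L * ‖c₂ - x‖ < Real.cos (ψ - t) := by
          rw [← hb1]; exact Real.cos_lt_cos_of_nonneg_of_le_pi (by linarith) (by linarith) h
        rw [real_inner_smul_left, i2]
        calc σ₂ * ‖c₂ - x‖ ^ 2 = L * (‖c₂ - x‖ * (σ₂ / L * ‖c₂ - x‖)) := by field_simp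
          _ < _ := by gcongr
      · right
        rw [h, sub_self, Real.cos_zero, mul_one] at i2
        rw [h', Real.cos_zero] at hb1
        have : u = ‖c₂ - x‖⁻¹ • (c₂ - x) := by
          have := (inner_eq_norm_mul_iff_real (x := u) (y := c₂ - x)).1 (by rw [i2, hu, one_mul])
          rw [hu, one_smul] at this
          rwa [eq_inv_smul_iff₀ hq0.ne']
        rw [this, smul_smul]
        congr 1
        field_simp at hb1 ⊢
        linarith
  -- At a tangency point `x` lies between the centres, and the two pure quadratics have opposite
  -- gradients of norm `L`.
  · refine ⟨σ₁ • (x - c₁), ?_, Or.inr rfl, Or.inr ?_⟩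
    · rw [norm_smul, h1, Real.norm_of_nonneg hσ₁.le, mul_div_cancel₀ _ hσ₁.ne']
    · have hs : SameRay ℝ (x - c₁) (c₂ - x) := by
        rw [sameRay_iff_norm_add, h1, ← norm_neg (c₂ - x), neg_sub, h2, sub_add_sub_cancel', hd]
        ring
      have := sameRay_iff_norm_smul_eq.1 hs
      rw [h1, ← norm_neg (c₂ - x), neg_sub, h2] at this
      have e := congrArg (fun z => (σ₁ * σ₂ / L) • z) this
      simp only [smul_smul] at e
      rw [show σ₁ * σ₂ / L * (L / σ₁) = σ₂ by field_simp,
        show σ₁ * σ₂ / L * (L / σ₂) = σ₁ by field_simp] at e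
      rw [← e, ← smul_neg, neg_sub]

end Regions

end PotentialRegion

namespace PotentialRegion

open InnerProductGeometry Filter Topology

/-! ### Monotonicity along rays and equality of the frontiers -/

section Rays

variable {n : ℕ} {c c₁ c₂ v x : E n} {σ₁ σ₂ L a b t : ℝ}

/-- A point off the segment lies on a ray that starts at its nearest point of the segment. -/
theorem exists_ray_of_notMem_segment (hx : x ∉ segment ℝ c₁ c₂) :
    ∃ c v : E n, ∃ t : ℝ, x = c + v ∧ v ≠ 0 ∧ c = c₁ + t • (c₂ - c₁) ∧ 0 ≤ t ∧ t ≤ 1 ∧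
      0 ≤ inner ℝ v (c - c₁) ∧ 0 ≤ inner ℝ v (c - c₂) := by
  have hconv : Convex ℝ (segment ℝ c₁ c₂) := convex_segment _ _
  have hcomp : IsCompact (segment ℝ c₁ c₂) := by
    rw [segment_eq_image']
    exact isCompact_Icc.image (by fun_prop)
  obtain ⟨c, hc, hmin⟩ := exists_norm_eq_iInf_of_complete_convex
    ⟨c₁, left_mem_segment ℝ c₁ c₂⟩ hcomp.isComplete hconv x
  have h := (norm_eq_iInf_iff_real_inner_le_zero hconv hc).1 hmin
  have h1 := h c₁ (left_mem_segment ℝ c₁ c₂)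
  have h2 := h c₂ (right_mem_segment ℝ c₁ c₂)
  have hc' := hc
  rw [segment_eq_image'] at hc'
  obtain ⟨t, ⟨ht0, ht1⟩, rfl⟩ := hc'
  refine ⟨_, x - (c₁ + t • (c₂ - c₁)), t, (add_sub_cancel _ _).symm, ?_, rfl, ht0, ht1, ?_, ?_⟩
  · intro h0
    rw [sub_eq_zero.1 h0] at hx
    exact hx hc
  · rw [← neg_sub c₁ (c₁ + t • (c₂ - c₁)), inner_neg_right]; linarith
  · rw [← neg_sub c₂, inner_neg_right]; linarith

theorem norm_ray_sub_lt (hv : v ≠ 0) (h : 0 ≤ inner ℝ v (c - c₁)) (ha : 0 ≤ a) (hab : a < b) :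
    ‖c + a • v - c₁‖ < ‖c + b • v - c₁‖ := by
  have e : ∀ s : ℝ, ‖c + s • v - c₁‖ ^ 2 =
      s ^ 2 * ‖v‖ ^ 2 + 2 * s * inner ℝ v (c - c₁) + ‖c - c₁‖ ^ 2 := by
    intro s
    rw [show c + s • v - c₁ = s • v + (c - c₁) by abel, norm_add_sq_real, norm_smul,
      real_inner_smul_left, mul_pow, Real.norm_eq_abs, sq_abs]
    ring
  refine lt_of_pow_lt_pow_left₀ 2 (norm_nonneg _) ?_
  rw [e, e]
  have : 0 < ‖v‖ := norm_pos_iff.2 hv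
  have h1 : a ^ 2 * ‖v‖ ^ 2 < b ^ 2 * ‖v‖ ^ 2 := by gcongr
  have h2 : 2 * a * inner ℝ v (c - c₁) ≤ 2 * b * inner ℝ v (c - c₁) := by gcongr
  linarith

theorem ray_ne (hv : v ≠ 0) (h : 0 ≤ inner ℝ v (c - c₁)) (ha : 0 < a) : c + a • v ≠ c₁ := by
  have := (norm_nonneg _).trans_lt (norm_ray_sub_lt hv h le_rfl ha)
  exact sub_ne_zero.1 (norm_pos_iff.1 this)

/-- The outward move is split in two: first `x - c₁` and then `c₂ - x` is updated. Each update is a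
positive rescaling minus a nonnegative multiple of the other vector, so neither decreases the angle.
-/
theorem psi_ray_le (hc : c₁ ≠ c₂) (hv : v ≠ 0) (hct : c = c₁ + t • (c₂ - c₁)) (ht0 : 0 ≤ t)
    (ht1 : t ≤ 1) (h₁ : 0 ≤ inner ℝ v (c - c₁)) (h₂ : 0 ≤ inner ℝ v (c - c₂)) (ha : 0 < a)
    (hab : a < b) : psi c₁ c₂ (c + a • v) ≤ psi c₁ c₂ (c + b • v) := by
  have hb : 0 < b := ha.trans hab
  have hpa := sub_ne_zero.2 (ray_ne hv h₁ ha)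
  have hpb := sub_ne_zero.2 (ray_ne hv h₁ hb)
  have hqa := sub_ne_zero.2 (ray_ne hv h₂ ha).symm
  have hqb := sub_ne_zero.2 (ray_ne hv h₂ hb).symm
  rw [psi_eq_angle hc, psi_eq_angle hc]
  have hr : 1 < b / a := (one_lt_div ha).2 hab
  obtain ⟨m, hme⟩ : ∃ m, m = a * t + (1 - t) * b := ⟨_, rfl⟩
  have hm : 0 < m := by nlinarith
  have ep : c + b • v - c₁ = ((1 - t) * (b / a) + t) • (c + a • v - c₁) -
      (t * (b / a - 1)) • (c₂ - (c + a • v)) := by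
    rw [hct]
    match_scalars <;> field_simp <;> ring
  have eq : c₂ - (c + b • v) = (b / m) • (c₂ - (c + a • v)) -
      ((1 - t) * (b - a) / m) • (c + b • v - c₁) := by
    rw [hct]
    match_scalars <;> field_simp <;> (try simp only [hme]) <;> ring
  calc angle (c + a • v - c₁) (c₂ - (c + a • v))
      ≤ angle (c + b • v - c₁) (c₂ - (c + a • v)) := by
        rw [ep]
        exact angle_le_angle_smul_sub_smul (by nlinarith)
          (mul_nonneg ht0 (by linarith)) hpa (ep ▸ hpb)
    _ ≤ angle (c + b • v - c₁) (c₂ - (c + b • v)) := by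
        rw [angle_comm, angle_comm _ (c₂ - (c + b • v))]
        nth_rw 1 [eq]
        exact angle_le_angle_smul_sub_smul (by positivity)
          (div_nonneg (mul_nonneg (by linarith) (by linarith)) hm.le) hqa (eq ▸ hqb)

/-- Moving outward strictly increases both distances, so both `phiTilde` terms drop, while `psi`
does not decrease. -/
theorem angleGap_ray_lt (hc : c₁ ≠ c₂) (hσ₁ : 0 < σ₁) (hσ₂ : 0 < σ₂) (hL : 0 < L) (hv : v ≠ 0)
    (hct : c = c₁ + t • (c₂ - c₁)) (ht0 : 0 ≤ t) (ht1 : t ≤ 1)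
    (h₁ : 0 ≤ inner ℝ v (c - c₁)) (h₂ : 0 ≤ inner ℝ v (c - c₂)) (ha : 0 < a) (hab : a < b)
    (hD : c + b • v ∈ angleDomain c₁ c₂ σ₁ σ₂ L) :
    c + a • v ∈ angleDomain c₁ c₂ σ₁ σ₂ L ∧
      angleGap c₁ c₂ σ₁ σ₂ L (c + b • v) < angleGap c₁ c₂ σ₁ σ₂ L (c + a • v) := by
  obtain ⟨⟨d1, d2⟩, -, -⟩ := mem_angleDomain_iff.1 hD
  have l1 := norm_ray_sub_lt hv h₁ ha.le hab
  have l2 := norm_ray_sub_lt hv h₂ ha.le hab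
  refine ⟨mem_angleDomain_iff.2 ⟨⟨l1.le.trans d1, l2.le.trans d2⟩, ray_ne hv h₁ ha,
    ray_ne hv h₂ ha⟩, ?_⟩
  have := psi_ray_le hc hv hct ht0 ht1 h₁ h₂ ha hab
  unfold angleGap
  linarith [phiTilde_lt_phiTilde hσ₁ hL d1 l1, phiTilde_lt_phiTilde hσ₂ hL d2 l2]

theorem psi_eq_zero_of_mem_segment (hc : c₁ ≠ c₂) (hx : x ∈ segment ℝ c₁ c₂) (h₁ : x ≠ c₁)
    (h₂ : x ≠ c₂) : psi c₁ c₂ x = 0 := by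
  rw [psi_eq_angle hc]
  rw [segment_eq_image'] at hx
  obtain ⟨t, ⟨ht0, ht1⟩, rfl⟩ := hx
  have hw : c₂ - c₁ ≠ 0 := sub_ne_zero.2 hc.symm
  have ht : t ≠ 0 := by rintro rfl; simp at h₁
  have ht' : t ≠ 1 := by rintro rfl; simp at h₂
  simp only
  rw [show c₁ + t • (c₂ - c₁) - c₁ = t • (c₂ - c₁) by abel,
    show c₂ - (c₁ + t • (c₂ - c₁)) = (1 - t) • (c₂ - c₁) by module,
    angle_smul_left_of_pos _ _ (ht0.lt_of_ne' ht),
    angle_smul_right_of_pos _ _ (sub_pos.2 (ht1.lt_of_ne ht')), angle_self hw]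

theorem angleGap_pos_or_mem_tangencySet (hc : c₁ ≠ c₂) (hσ₁ : 0 < σ₁) (hσ₂ : 0 < σ₂)
    (hL : 0 < L) (hx : x ∈ segment ℝ c₁ c₂) (hD : x ∈ angleDomain c₁ c₂ σ₁ σ₂ L) :
    0 < angleGap c₁ c₂ σ₁ σ₂ L x ∨ x ∈ tangencySet c₁ c₂ σ₁ σ₂ L := by
  obtain ⟨⟨d1, d2⟩, h1, h2⟩ := mem_angleDomain_iff.1 hD
  rw [angleGap, psi_eq_zero_of_mem_segment hc hx h1 h2, sub_zero]
  rcases d1.lt_or_eq with d1 | d1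
  · exact Or.inl (add_pos_of_pos_of_nonneg ((phiTilde_pos_iff hσ₁ hL).2 d1) phiTilde_nonneg)
  rcases d2.lt_or_eq with d2 | d2
  · exact Or.inl (add_pos_of_nonneg_of_pos phiTilde_nonneg ((phiTilde_pos_iff hσ₂ hL).2 d2))
  refine Or.inr ⟨?_, d1, d2⟩
  have := dist_add_dist_of_mem_segment hx
  rw [dist_comm c₁ x, dist_comm c₁ c₂, dist_eq_norm, dist_eq_norm, dist_eq_norm, d1, d2] at this
  rw [← this]
  ring

/-- Pulling a point off the segment slightly towards its nearest point on the segment makes the gap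
strictly positive. -/
theorem outerRegion_subset_closure_innerRegion (hc : c₁ ≠ c₂) (hσ₁ : 0 < σ₁) (hσ₂ : 0 < σ₂)
    (hL : 0 < L) : outerRegion c₁ c₂ σ₁ σ₂ L ⊆ closure (innerRegion c₁ c₂ σ₁ σ₂ L) := by
  intro x hx
  obtain ⟨hD, hgap⟩ := mem_outerRegion_iff.1 hx
  by_cases hs : x ∈ segment ℝ c₁ c₂
  · apply subset_closure
    rw [mem_innerRegion_iff]
    rcases angleGap_pos_or_mem_tangencySet hc hσ₁ hσ₂ hL hs hD with h | h
    · exact Or.inl ⟨hD, h⟩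
    · exact Or.inr h
  · obtain ⟨c, v, t, rfl, hv, hct, ht0, ht1, h1, h2⟩ := exists_ray_of_notMem_segment hs
    have hlim : Tendsto (fun s : ℝ => c + s • v) (𝓝[<] 1) (𝓝 (c + v)) := by
      have : Tendsto (fun s : ℝ => c + s • v) (𝓝 1) (𝓝 (c + (1 : ℝ) • v)) :=
        (by fun_prop : Continuous fun s : ℝ => c + s • v).tendsto 1
      rw [one_smul] at this
      exact this.mono_left nhdsWithin_le_nhds
    refine mem_closure_of_tendsto hlim ?_
    filter_upwards [Ioo_mem_nhdsLT (zero_lt_one' ℝ)] with s hs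
    rw [← one_smul ℝ v] at hD hgap
    have := angleGap_ray_lt hc hσ₁ hσ₂ hL hv hct ht0 ht1 h1 h2 hs.1 hs.2 hD
    exact mem_innerRegion_iff.2 (Or.inl ⟨this.1, hgap.trans_lt this.2⟩)

theorem continuousAt_angleGap (hc : c₁ ≠ c₂) (h₁ : x ≠ c₁) (h₂ : x ≠ c₂) :
    ContinuousAt (angleGap c₁ c₂ σ₁ σ₂ L) x := by
  have hal : ∀ c : E n, x ≠ c → ContinuousAt (fun y => alpha c₁ c₂ c y) x := by
    intro c h
    exact ContinuousAt.comp (f := fun y : E n => (y - c, c₂ - c₁))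
      (continuousAt_angle (x := (x - c, c₂ - c₁)) (sub_ne_zero.2 h) (sub_ne_zero.2 hc.symm))
      (by fun_prop)
  have hph : ∀ (c : E n) (σ : ℝ), ContinuousAt (phiTilde c σ L) x := by
    intro c σ
    exact (Real.continuous_arccos.comp (by fun_prop)).continuousAt
  exact ((hph _ _).add (hph _ _)).sub (continuousAt_const.sub ((hal _ h₂).sub (hal _ h₁)))

theorem interior_outerRegion (hc : c₁ ≠ c₂) (hσ₁ : 0 < σ₁) (hσ₂ : 0 < σ₂) (hL : 0 < L) :
    interior (outerRegion c₁ c₂ σ₁ σ₂ L) =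
      {x | (‖x - c₁‖ < L / σ₁ ∧ ‖x - c₂‖ < L / σ₂) ∧ (x ≠ c₁ ∧ x ≠ c₂) ∧
        0 < angleGap c₁ c₂ σ₁ σ₂ L x} := by
  ext x
  constructor
  · intro hx
    have hball : ∀ (c : E n) (σ : ℝ), 0 < σ →
        outerRegion c₁ c₂ σ₁ σ₂ L ⊆ Metric.closedBall c (L / σ) → ‖x - c‖ < L / σ := by
      intro c σ hσ h
      have := interior_mono h hx
      rwa [interior_closedBall _ (div_pos hL hσ).ne', mem_ball_iff_norm] at this
    have d1 := hball c₁ σ₁ hσ₁ fun y hy => hy.1.1.1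
    have d2 := hball c₂ σ₂ hσ₂ fun y hy => hy.1.1.2
    obtain ⟨hD, hgap⟩ := mem_outerRegion_iff.1 (interior_subset hx)
    obtain ⟨-, hne⟩ := mem_angleDomain_iff.1 hD
    refine ⟨⟨d1, d2⟩, hne, ?_⟩
    by_cases hs : x ∈ segment ℝ c₁ c₂
    · exact (angleGap_pos_or_mem_tangencySet hc hσ₁ hσ₂ hL hs hD).resolve_right
        fun h => d1.ne h.2.1
    · obtain ⟨c, v, t, rfl, hv, hct, ht0, ht1, h1, h2⟩ := exists_ray_of_notMem_segment hs
      have hlim : Tendsto (fun s : ℝ => c + s • v) (𝓝[>] 1) (𝓝 (c + v)) := by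
        have : Tendsto (fun s : ℝ => c + s • v) (𝓝 1) (𝓝 (c + (1 : ℝ) • v)) :=
          (by fun_prop : Continuous fun s : ℝ => c + s • v).tendsto 1
        rw [one_smul] at this
        exact this.mono_left nhdsWithin_le_nhds
      -- A point slightly further out is still in the outer set, so its gap is nonnegative and the
      -- gap at `x` is strictly larger.
      obtain ⟨s, hs, hs1⟩ := ((hlim.eventually (mem_interior_iff_mem_nhds.1 hx)).and
        self_mem_nhdsWithin).exists
      obtain ⟨hD', hgap'⟩ := mem_outerRegion_iff.1 hs
      have := (angleGap_ray_lt hc hσ₁ hσ₂ hL hv hct ht0 ht1 h1 h2 one_pos hs1 hD').2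
      rw [one_smul] at this
      exact hgap'.trans_lt this
  · rintro ⟨⟨d1, d2⟩, ⟨h1, h2⟩, hgap⟩
    rw [mem_interior_iff_mem_nhds]
    have cn : ∀ c : E n, ContinuousAt (fun y : E n => ‖y - c‖) x := fun c => by fun_prop
    filter_upwards [(cn c₁).eventually_lt continuousAt_const d1,
      (cn c₂).eventually_lt continuousAt_const d2, eventually_ne_nhds h1, eventually_ne_nhds h2,
      (continuousAt_angleGap hc h1 h2).eventually (lt_mem_nhds hgap)] with y a b c d e
    exact mem_outerRegion_iff.2 ⟨mem_angleDomain_iff.2 ⟨⟨a.le, b.le⟩, c, d⟩, le_of_lt e⟩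

theorem frontier_eq_of_subset_of_subset {X : Type*} [TopologicalSpace X] {A B C : Set X}
    (hAB : A ⊆ B) (hBC : B ⊆ C) (h₁ : C ⊆ closure A) (h₂ : interior C ⊆ A) :
    frontier B = frontier C := by
  have hcl : closure B = closure C :=
    (closure_mono hBC).antisymm (closure_minimal (h₁.trans (closure_mono hAB)) isClosed_closure)
  have hint : interior B = interior C :=
    (interior_mono hBC).antisymm (interior_maximal (h₂.trans hAB) isOpen_interior)
  rw [frontier, frontier, hcl, hint]

theorem interior_outerRegion_subset_innerRegion (hc : c₁ ≠ c₂) (hσ₁ : 0 < σ₁) (hσ₂ : 0 < σ₂)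
    (hL : 0 < L) : interior (outerRegion c₁ c₂ σ₁ σ₂ L) ⊆ innerRegion c₁ c₂ σ₁ σ₂ L := by
  intro x hx
  have hD := (interior_subset hx).1
  rw [interior_outerRegion hc hσ₁ hσ₂ hL] at hx
  exact mem_innerRegion_iff.2 (Or.inl ⟨hD, hx.2.2⟩)

theorem frontier_solutionRegion_eq_outerRegion (hc : c₁ ≠ c₂) (hσ₁ : 0 < σ₁) (hσ₂ : 0 < σ₂)
    (hL : 0 < L) : frontier (solutionRegion c₁ c₂ σ₁ σ₂ L) =
      frontier (outerRegion c₁ c₂ σ₁ σ₂ L) :=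
  frontier_eq_of_subset_of_subset (innerRegion_subset_solutionRegion hc hσ₁ hσ₂ hL)
    (solutionRegion_subset_outerRegion hc hσ₁ hσ₂ hL)
    (outerRegion_subset_closure_innerRegion hc hσ₁ hσ₂ hL)
    (interior_outerRegion_subset_innerRegion hc hσ₁ hσ₂ hL)

theorem frontier_innerRegion_eq_outerRegion (hc : c₁ ≠ c₂) (hσ₁ : 0 < σ₁) (hσ₂ : 0 < σ₂)
    (hL : 0 < L) : frontier (innerRegion c₁ c₂ σ₁ σ₂ L) =
      frontier (outerRegion c₁ c₂ σ₁ σ₂ L) :=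
  frontier_eq_of_subset_of_subset subset_rfl
    ((innerRegion_subset_solutionRegion hc hσ₁ hσ₂ hL).trans
      (solutionRegion_subset_outerRegion hc hσ₁ hσ₂ hL))
    (outerRegion_subset_closure_innerRegion hc hσ₁ hσ₂ hL)
    (interior_outerRegion_subset_innerRegion hc hσ₁ hσ₂ hL)

end Rays

end PotentialRegion

namespace PotentialRegion

open InnerProductGeometry Filter Topology

/-! ### Description of the frontier by spheres, zero gap and centres -/

section Frontier

variable {n : ℕ} {c₁ c₂ x : E n} {σ₁ σ₂ L : ℝ}

theorem angleDomain_comm : angleDomain c₂ c₁ σ₂ σ₁ L = angleDomain c₁ c₂ σ₁ σ₂ L := by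
  unfold angleDomain
  rw [Set.inter_comm, Set.pair_comm]

theorem outerRegion_comm (hc : c₁ ≠ c₂) :
    outerRegion c₂ c₁ σ₂ σ₁ L = outerRegion c₁ c₂ σ₁ σ₂ L := by
  ext x
  rw [mem_outerRegion_iff, mem_outerRegion_iff, angleDomain_comm, angleGap_comm hc]

theorem closure_outerRegion_subset_closedBalls :
    closure (outerRegion c₁ c₂ σ₁ σ₂ L) ⊆
      Metric.closedBall c₁ (L / σ₁) ∩ Metric.closedBall c₂ (L / σ₂) :=
  closure_minimal (fun _ hx => hx.1.1) (Metric.isClosed_closedBall.inter Metric.isClosed_closedBall)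

theorem mem_outerRegion_of_mem_closure (hc : c₁ ≠ c₂) (h₁ : x ≠ c₁) (h₂ : x ≠ c₂)
    (hx : x ∈ closure (outerRegion c₁ c₂ σ₁ σ₂ L)) : x ∈ outerRegion c₁ c₂ σ₁ σ₂ L := by
  refine mem_outerRegion_iff.2 ⟨⟨closure_outerRegion_subset_closedBalls hx, by simp [h₁, h₂]⟩, ?_⟩
  by_contra! hlt
  obtain ⟨y, hy, hy'⟩ := mem_closure_iff_nhds.1 hx _
    ((continuousAt_angleGap (σ₁ := σ₁) (σ₂ := σ₂) (L := L) hc h₁ h₂).eventually (gt_mem_nhds hlt))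
  exact absurd (mem_outerRegion_iff.1 hy').2 (not_le.2 hy)

/-- The centre is approached along the segment, where `psi` vanishes and only the ball constraints
remain. -/
theorem center_mem_closure_outerRegion_iff (hc : c₁ ≠ c₂) (hσ₁ : 0 < σ₁) (hL : 0 < L) :
    c₁ ∈ closure (outerRegion c₁ c₂ σ₁ σ₂ L) ↔ ‖c₂ - c₁‖ ≤ L / σ₂ := by
  constructor
  · intro h
    have := (closure_outerRegion_subset_closedBalls h).2
    rwa [mem_closedBall_iff_norm'] at this
  · intro h
    have hcont : Continuous fun s : ℝ => c₁ + s • (c₂ - c₁) := by fun_prop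
    have h0 : Tendsto (fun s : ℝ => c₁ + s • (c₂ - c₁)) (𝓝[>] 0) (𝓝 c₁) := by
      have := hcont.tendsto 0
      rw [zero_smul, add_zero] at this
      exact this.mono_left nhdsWithin_le_nhds
    refine mem_closure_of_tendsto h0 ?_
    filter_upwards [h0.eventually (Metric.closedBall_mem_nhds c₁ (div_pos hL hσ₁)),
      Ioo_mem_nhdsGT (zero_lt_one' ℝ)] with s hs hs1
    have hw : c₂ - c₁ ≠ 0 := sub_ne_zero.2 hc.symm
    have e1 : c₁ + s • (c₂ - c₁) - c₁ = s • (c₂ - c₁) := by abel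
    have e2 : c₁ + s • (c₂ - c₁) - c₂ = (-(1 - s)) • (c₂ - c₁) := by module
    have h1 : c₁ + s • (c₂ - c₁) ≠ c₁ := by
      rw [← sub_ne_zero, e1]; exact smul_ne_zero hs1.1.ne' hw
    have h2 : c₁ + s • (c₂ - c₁) ≠ c₂ := by
      rw [← sub_ne_zero, e2]; exact smul_ne_zero (by linarith [hs1.2]) hw
    refine mem_outerRegion_iff.2 ⟨⟨⟨hs, ?_⟩, by simp [h1, h2]⟩, ?_⟩
    · rw [mem_closedBall_iff_norm, e2, norm_smul, norm_neg,
        Real.norm_of_nonneg (by linarith [hs1.2])]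
      nlinarith [norm_nonneg (c₂ - c₁), hs1.1]
    · have : c₁ + s • (c₂ - c₁) ∈ segment ℝ c₁ c₂ := by
        rw [segment_eq_image']
        exact ⟨s, ⟨hs1.1.le, hs1.2.le⟩, rfl⟩
      rw [angleGap, psi_eq_zero_of_mem_segment hc this h1 h2, sub_zero]
      exact add_nonneg phiTilde_nonneg phiTilde_nonneg

theorem mem_frontier_outerRegion_iff (hc : c₁ ≠ c₂) (hσ₁ : 0 < σ₁) (hσ₂ : 0 < σ₂) (hL : 0 < L) :
    x ∈ frontier (outerRegion c₁ c₂ σ₁ σ₂ L) ↔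
      (‖x - c₁‖ = L / σ₁ ∧ x ∈ angleDomain c₁ c₂ σ₁ σ₂ L ∧ 0 < angleGap c₁ c₂ σ₁ σ₂ L x) ∨
      (‖x - c₂‖ = L / σ₂ ∧ x ∈ angleDomain c₁ c₂ σ₁ σ₂ L ∧ 0 < angleGap c₁ c₂ σ₁ σ₂ L x) ∨
      (x ∈ angleDomain c₁ c₂ σ₁ σ₂ L ∧ angleGap c₁ c₂ σ₁ σ₂ L x = 0) ∨
      (x = c₁ ∧ ‖c₂ - c₁‖ ≤ L / σ₂) ∨ (x = c₂ ∧ ‖c₂ - c₁‖ ≤ L / σ₁) := by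
  have hnc : ∀ y ∈ interior (outerRegion c₁ c₂ σ₁ σ₂ L), y ≠ c₁ ∧ y ≠ c₂ := fun y hy =>
    (mem_angleDomain_iff.1 (interior_subset hy).1).2
  rcases eq_or_ne x c₁ with rfl | h1
  · rw [frontier, Set.mem_sdiff, center_mem_closure_outerRegion_iff hc hσ₁ hL]
    have h : x ∉ interior (outerRegion x c₂ σ₁ σ₂ L) := fun h => (hnc x h).1 rfl
    simp [h, mem_angleDomain_iff, hc]
  rcases eq_or_ne x c₂ with rfl | h2
  · rw [frontier, Set.mem_sdiff, ← outerRegion_comm hc,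
      center_mem_closure_outerRegion_iff hc.symm hσ₂ hL, outerRegion_comm hc, norm_sub_rev]
    have h : x ∉ interior (outerRegion c₁ x σ₁ σ₂ L) := fun h => (hnc x h).2 rfl
    simp [h, mem_angleDomain_iff, hc.symm]
  have hcl : x ∈ closure (outerRegion c₁ c₂ σ₁ σ₂ L) ↔ x ∈ outerRegion c₁ c₂ σ₁ σ₂ L :=
    ⟨mem_outerRegion_of_mem_closure hc h1 h2, fun h => subset_closure h⟩
  rw [frontier, Set.mem_sdiff, hcl, mem_outerRegion_iff, interior_outerRegion hc hσ₁ hσ₂ hL]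
  simp only [Set.mem_ofPred_eq, h1, h2, false_and, or_false, ne_eq, not_false_eq_true, and_true,
    true_and]
  constructor
  · rintro ⟨⟨hD, hg⟩, hn⟩
    rcases hg.eq_or_lt with hg | hg
    · exact Or.inr (Or.inr ⟨hD, hg.symm⟩)
    obtain ⟨⟨d1, d2⟩, -⟩ := mem_angleDomain_iff.1 hD
    rcases d1.lt_or_eq with d1 | d1
    · rcases d2.lt_or_eq with d2 | d2
      · exact absurd ⟨⟨d1, d2⟩, hg⟩ hn
      · exact Or.inr (Or.inl ⟨d2, hD, hg⟩)
    · exact Or.inl ⟨d1, hD, hg⟩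
  · rintro (⟨d, hD, hg⟩ | ⟨d, hD, hg⟩ | ⟨hD, hg⟩)
    · exact ⟨⟨hD, hg.le⟩, fun h => h.1.1.ne d⟩
    · exact ⟨⟨hD, hg.le⟩, fun h => h.1.2.ne d⟩
    · exact ⟨⟨hD, hg.ge⟩, fun h => h.2.ne' hg⟩

/-- On this sphere `φ₁ = 0`, so the condition is `ψ < φ₂`, compared through cosines. The inner
product inequality alone already forces `x` into the second ball, by Cauchy–Schwarz. -/
theorem angleGap_pos_on_sphere_iff (hc : c₁ ≠ c₂) (hσ₁ : 0 < σ₁) (hσ₂ : 0 < σ₂) (hL : 0 < L)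
    (h : ‖x - c₁‖ = L / σ₁) :
    (x ∈ angleDomain c₁ c₂ σ₁ σ₂ L ∧ 0 < angleGap c₁ c₂ σ₁ σ₂ L x) ↔
      σ₂ / σ₁ * ‖x - c₂‖ ^ 2 < inner ℝ (x - c₁) (c₂ - x) := by
  have hd1 : 0 < ‖x - c₁‖ := h ▸ div_pos hL hσ₁
  have key : x ≠ c₂ → ‖x - c₂‖ ≤ L / σ₂ → (0 < angleGap c₁ c₂ σ₁ σ₂ L x ↔
      σ₂ / σ₁ * ‖x - c₂‖ ^ 2 < inner ℝ (x - c₁) (c₂ - x)) := by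
    intro h2 d2
    have hd2 : 0 < ‖c₂ - x‖ := norm_pos_iff.2 (sub_ne_zero.2 h2.symm)
    rw [angleGap, phiTilde_eq_zero hσ₁ hL h, zero_add, sub_pos, psi_eq_angle hc,
      ← Real.strictAntiOn_cos.lt_iff_gt
        ⟨phiTilde_nonneg, by linarith [phiTilde_lt_pi_div_two hσ₂ hL h2, Real.pi_pos]⟩
        ⟨angle_nonneg _ _, angle_le_pi _ _⟩,
      cos_phiTilde hσ₂ hL d2, cos_angle, lt_div_iff₀ (by positivity), h, norm_sub_rev c₂ x]
    have : σ₂ / L * ‖x - c₂‖ * (L / σ₁ * ‖x - c₂‖) = σ₂ / σ₁ * ‖x - c₂‖ ^ 2 := by field_simp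
    rw [this]
  constructor
  · rintro ⟨hD, hg⟩
    obtain ⟨⟨-, d2⟩, -, h2⟩ := mem_angleDomain_iff.1 hD
    exact (key h2 d2).1 hg
  · intro hlt
    have h2 : x ≠ c₂ := by rintro rfl; simp at hlt
    have hd2 : 0 < ‖x - c₂‖ := norm_pos_iff.2 (sub_ne_zero.2 h2)
    have d2 : ‖x - c₂‖ ≤ L / σ₂ := by
      have h3 := hlt.trans_le (real_inner_le_norm _ _)
      rw [norm_sub_rev c₂ x, h, pow_two, ← mul_assoc] at h3
      have h4 := lt_of_mul_lt_mul_right h3 hd2.le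
      rw [div_mul_eq_mul_div, div_lt_div_iff_of_pos_right hσ₁] at h4
      exact ((lt_div_iff₀' hσ₂).2 h4).le
    exact ⟨mem_angleDomain_iff.2 ⟨⟨h.le, d2⟩, sub_ne_zero.1 (norm_pos_iff.1 hd1), h2⟩,
      (key h2 d2).2 hlt⟩

theorem angleGap_pos_on_second_sphere_iff (hc : c₁ ≠ c₂) (hσ₁ : 0 < σ₁) (hσ₂ : 0 < σ₂)
    (hL : 0 < L) (h : ‖x - c₂‖ = L / σ₂) :
    (x ∈ angleDomain c₁ c₂ σ₁ σ₂ L ∧ 0 < angleGap c₁ c₂ σ₁ σ₂ L x) ↔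
      σ₁ / σ₂ * ‖x - c₁‖ ^ 2 < inner ℝ (x - c₁) (c₂ - x) := by
  rw [← angleDomain_comm, ← angleGap_comm hc, angleGap_pos_on_sphere_iff hc.symm hσ₂ hσ₁ hL h,
    ← inner_neg_neg, neg_sub, neg_sub, real_inner_comm]

theorem inner_nonpos_of_norm_le (h : ‖c₂ - c₁‖ ≤ ‖x - c₁‖) :
    inner ℝ (x - c₁) (c₂ - x) ≤ 0 := by
  rw [show c₂ - x = (c₂ - c₁) - (x - c₁) by abel, inner_sub_right, real_inner_self_eq_norm_sq]
  nlinarith [real_inner_le_norm (x - c₁) (c₂ - c₁), norm_nonneg (x - c₁)]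

/-- No point of the first sphere lies strictly inside when that sphere encloses both centres. -/
theorem not_angleGap_pos_on_sphere (hc : c₁ ≠ c₂) (hσ₁ : 0 < σ₁) (hσ₂ : 0 < σ₂) (hL : 0 < L)
    (hr : ‖c₂ - c₁‖ ≤ L / σ₁) (h : ‖x - c₁‖ = L / σ₁) :
    ¬ (x ∈ angleDomain c₁ c₂ σ₁ σ₂ L ∧ 0 < angleGap c₁ c₂ σ₁ σ₂ L x) := by
  rw [angleGap_pos_on_sphere_iff hc hσ₁ hσ₂ hL h]
  have := inner_nonpos_of_norm_le (h ▸ hr : ‖c₂ - c₁‖ ≤ ‖x - c₁‖)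
  have h0 : 0 ≤ σ₂ / σ₁ * ‖x - c₂‖ ^ 2 := by positivity
  linarith

theorem not_angleGap_pos_on_second_sphere (hc : c₁ ≠ c₂) (hσ₁ : 0 < σ₁) (hσ₂ : 0 < σ₂)
    (hL : 0 < L) (hr : ‖c₂ - c₁‖ ≤ L / σ₂) (h : ‖x - c₂‖ = L / σ₂) :
    ¬ (x ∈ angleDomain c₁ c₂ σ₁ σ₂ L ∧ 0 < angleGap c₁ c₂ σ₁ σ₂ L x) := by
  rw [← angleDomain_comm, ← angleGap_comm hc]
  exact not_angleGap_pos_on_sphere hc.symm hσ₂ hσ₁ hL (norm_sub_rev c₁ c₂ ▸ hr) h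

theorem sqrt_one_div_sq_sub {d s : ℝ} (hd : 0 < d) :
    Real.sqrt (1 / d ^ 2 - s ^ 2) = Real.sqrt (1 - (s * d) ^ 2) / d := by
  rw [show 1 / d ^ 2 - s ^ 2 = (1 - (s * d) ^ 2) / d ^ 2 by field_simp,
    Real.sqrt_div' _ (sq_nonneg d), Real.sqrt_sq hd.le]

/-- Both `φ₁ + φ₂` and `ψ` lie in `[0, π]`, where cosine is injective; the addition formula divided
by the product of the distances is the stated equation. -/
theorem angleGap_eq_zero_iff (hc : c₁ ≠ c₂) (hσ₁ : 0 < σ₁) (hσ₂ : 0 < σ₂) (hL : 0 < L)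
    (hD : x ∈ angleDomain c₁ c₂ σ₁ σ₂ L) :
    angleGap c₁ c₂ σ₁ σ₂ L x = 0 ↔
      -inner ℝ (x - c₁) (c₂ - x) / (‖x - c₁‖ ^ 2 * ‖x - c₂‖ ^ 2) + σ₁ * σ₂ / L ^ 2 =
        Real.sqrt (1 / ‖x - c₁‖ ^ 2 - σ₁ ^ 2 / L ^ 2) *
          Real.sqrt (1 / ‖x - c₂‖ ^ 2 - σ₂ ^ 2 / L ^ 2) := by
  obtain ⟨⟨d1, d2⟩, h1, h2⟩ := mem_angleDomain_iff.1 hD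
  have hd1 : 0 < ‖x - c₁‖ := norm_pos_iff.2 (sub_ne_zero.2 h1)
  have hd2 : 0 < ‖x - c₂‖ := norm_pos_iff.2 (sub_ne_zero.2 h2)
  rw [angleGap, psi_eq_angle hc, sub_eq_zero, ← Real.injOn_cos.eq_iff
    ⟨add_nonneg phiTilde_nonneg phiTilde_nonneg, by
      linarith [phiTilde_lt_pi_div_two hσ₂ hL h2, phiTilde_lt_pi_div_two hσ₁ hL h1]⟩
    ⟨angle_nonneg _ _, angle_le_pi _ _⟩, Real.cos_add, cos_phiTilde hσ₁ hL d1,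
    cos_phiTilde hσ₂ hL d2, cos_angle, ← div_pow, ← div_pow, sqrt_one_div_sq_sub hd1,
    sqrt_one_div_sq_sub hd2, norm_sub_rev c₂ x, phiTilde, phiTilde, Real.sin_arccos,
    Real.sin_arccos]
  set A := Real.sqrt (1 - (σ₁ / L * ‖x - c₁‖) ^ 2)
  set B := Real.sqrt (1 - (σ₂ / L * ‖x - c₂‖) ^ 2)
  set I : ℝ := inner ℝ (x - c₁) (c₂ - x)
  set p := ‖x - c₁‖
  set q := ‖x - c₂‖
  have e1 : σ₁ / L * p * (σ₂ / L * q) - A * B - I / (p * q) =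
      p * q * (-I / (p ^ 2 * q ^ 2) + σ₁ * σ₂ / L ^ 2 - A / p * (B / q)) := by
    field_simp
    ring
  rw [← sub_eq_zero, e1, mul_eq_zero, or_iff_right (by positivity), sub_eq_zero]

theorem norm_sub_le_of_mem_solutionRegion (hc : c₁ ≠ c₂) (hσ₁ : 0 < σ₁) (hσ₂ : 0 < σ₂)
    (hL : 0 < L) (hx : x ∈ solutionRegion c₁ c₂ σ₁ σ₂ L) :
    ‖x - c₁‖ ≤ L / σ₁ ∧ ‖x - c₂‖ ≤ L / σ₂ :=
  (mem_angleDomain_iff.1 (solutionRegion_subset_outerRegion hc hσ₁ hσ₂ hL hx).1).1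

end Frontier

/-! ### Centres on the first axis: caps, hypersurface and the degenerate cases -/

section Coordinates

variable {n : ℕ} [NeZero n] {σ₁ σ₂ L r : ℝ}

theorem norm_sub_axisPoint_sq (x : E n) (t : ℝ) :
    ‖x - axisPoint n t‖ ^ 2 = ‖x‖ ^ 2 - 2 * t * x 0 + t ^ 2 := by
  rw [norm_sub_sq_real, axisPoint, EuclideanSpace.inner_single_right, PiLp.norm_single]
  simp
  ring

theorem inner_sub_axisPoint (x : E n) (r : ℝ) :
    inner ℝ (x - axisPoint n (-r)) (axisPoint n r - x) = r ^ 2 - ‖x‖ ^ 2 := by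
  have e : axisPoint n r = -axisPoint n (-r) := by
    ext i
    by_cases hi : i = 0 <;> simp [axisPoint, hi]
  have h := norm_sub_axisPoint_sq x (-r)
  rw [norm_sub_sq_real] at h
  have h' : ‖axisPoint n (-r)‖ ^ 2 = r ^ 2 := by simp [axisPoint]
  rw [e, inner_sub_left, inner_sub_right, inner_sub_right, inner_neg_right, inner_neg_right,
    real_inner_self_eq_norm_sq, real_inner_self_eq_norm_sq, h', real_inner_comm x]
  ring

theorem norm_axisPoint_sub_axisPoint (s t : ℝ) :
    ‖axisPoint n s - axisPoint n t‖ = |s - t| := by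
  have h0 : axisPoint n s 0 = s := by simp [axisPoint]
  have h1 : ‖axisPoint n s‖ ^ 2 = s ^ 2 := by simp [axisPoint]
  rw [← sq_eq_sq₀ (norm_nonneg _) (abs_nonneg _), sq_abs, norm_sub_axisPoint_sq, h0, h1]
  ring

theorem norm_center_sub_center (hr : 0 < r) : ‖axisPoint n r - axisPoint n (-r)‖ = 2 * r := by
  rw [norm_axisPoint_sub_axisPoint, sub_neg_eq_add, abs_of_pos (by linarith)]
  ring

theorem axisPoint_neg_ne (hr : 0 < r) : axisPoint n (-r) ≠ axisPoint n r := by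
  intro h
  have := norm_center_sub_center (n := n) hr
  rw [h, sub_self, norm_zero] at this
  linarith

theorem mem_curveT_iff (hr : 0 < r) (hσ₁ : 0 < σ₁) (hσ₂ : 0 < σ₂) (hL : 0 < L) {x : E n} :
    x ∈ curveT n r σ₁ σ₂ L ↔ x ∈ angleDomain (axisPoint n (-r)) (axisPoint n r) σ₁ σ₂ L ∧
      angleGap (axisPoint n (-r)) (axisPoint n r) σ₁ σ₂ L x = 0 := by
  unfold curveT
  rw [Set.mem_ofPred_eq]
  refine and_congr_right fun hD => ?_
  rw [angleGap_eq_zero_iff (axisPoint_neg_ne hr) hσ₁ hσ₂ hL hD, inner_sub_axisPoint, neg_sub]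

theorem mem_cap₁_iff (hr : 0 < r) (hσ₁ : 0 < σ₁) (hσ₂ : 0 < σ₂) (hL : 0 < L) {x : E n} :
    x ∈ cap₁ n r σ₁ σ₂ L ↔ ‖x - axisPoint n (-r)‖ = L / σ₁ ∧
      x ∈ angleDomain (axisPoint n (-r)) (axisPoint n r) σ₁ σ₂ L ∧
      0 < angleGap (axisPoint n (-r)) (axisPoint n r) σ₁ σ₂ L x := by
  rw [cap₁, frontier_ball _ (div_pos hL hσ₁).ne', Set.mem_inter_iff, mem_sphere_iff_norm]
  refine and_congr_right fun h => ?_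
  rw [angleGap_pos_on_sphere_iff (axisPoint_neg_ne hr) hσ₁ hσ₂ hL h, inner_sub_axisPoint,
    norm_sub_axisPoint_sq, Set.mem_compl_iff, Set.mem_ofPred_eq, not_le]
  -- The sphere equation expresses `L² / σ₁²` inside `lambda₁` through `‖x‖²` and `x 0`; after
  -- clearing denominators both inequalities coincide.
  have hs := norm_sub_axisPoint_sq x (-r)
  rw [h, div_pow] at hs
  unfold lambda₁
  rw [hs]
  set β := σ₂ / σ₁
  have hβ : 0 < β := div_pos hσ₂ hσ₁
  generalize ‖x‖ ^ 2 = N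
  generalize x 0 = y
  have e : (1 + β) / (1 + 2 * β) * ((N - 2 * -r * y + (-r) ^ 2) / (2 * r)) - r / (1 + 2 * β) =
      ((1 + β) * (N - 2 * -r * y + (-r) ^ 2) - 2 * r ^ 2) / (2 * r * (1 + 2 * β)) := by
    field_simp
  rw [e, div_lt_iff₀ (by positivity)]
  constructor <;> intro h <;> linarith

theorem mem_cap₂_iff (hr : 0 < r) (hσ₁ : 0 < σ₁) (hσ₂ : 0 < σ₂) (hL : 0 < L) {x : E n} :
    x ∈ cap₂ n r σ₁ σ₂ L ↔ ‖x - axisPoint n r‖ = L / σ₂ ∧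
      x ∈ angleDomain (axisPoint n (-r)) (axisPoint n r) σ₁ σ₂ L ∧
      0 < angleGap (axisPoint n (-r)) (axisPoint n r) σ₁ σ₂ L x := by
  rw [cap₂, frontier_ball _ (div_pos hL hσ₂).ne', Set.mem_inter_iff, mem_sphere_iff_norm]
  refine and_congr_right fun h => ?_
  rw [angleGap_pos_on_second_sphere_iff (axisPoint_neg_ne hr) hσ₁ hσ₂ hL h, inner_sub_axisPoint,
    norm_sub_axisPoint_sq, Set.mem_compl_iff, Set.mem_ofPred_eq, not_le]
  have hs := norm_sub_axisPoint_sq x r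
  rw [h, div_pow] at hs
  unfold lambda₂
  rw [hs]
  have hβ : 0 < σ₂ / σ₁ := div_pos hσ₂ hσ₁
  rw [← inv_div σ₂ σ₁]
  set β := σ₂ / σ₁
  generalize ‖x‖ ^ 2 = N
  generalize x 0 = y
  have e : -((1 + β) / (2 + β)) * ((N - 2 * r * y + r ^ 2) / (2 * r)) + β * r / (2 + β) =
      (-(1 + β) * (N - 2 * r * y + r ^ 2) + 2 * β * r ^ 2) / (2 * r * (2 + β)) := by
    field_simp
  rw [e, lt_div_iff₀ (by positivity), inv_mul_lt_iff₀ hβ]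
  constructor <;> intro h <;> linarith

/-- On both spheres at once the gap is `-ψ ≤ 0`. -/
theorem disjoint_cap₁_cap₂ (hr : 0 < r) (hσ₁ : 0 < σ₁) (hσ₂ : 0 < σ₂) (hL : 0 < L) :
    Disjoint (cap₁ n r σ₁ σ₂ L) (cap₂ n r σ₁ σ₂ L) := by
  rw [Set.disjoint_left]
  intro x h h'
  obtain ⟨d1, -, hg⟩ := (mem_cap₁_iff hr hσ₁ hσ₂ hL).1 h
  obtain ⟨d2, -⟩ := (mem_cap₂_iff hr hσ₁ hσ₂ hL).1 h'
  rw [angleGap, phiTilde_eq_zero hσ₁ hL d1, phiTilde_eq_zero hσ₂ hL d2,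
    psi_eq_angle (axisPoint_neg_ne hr)] at hg
  linarith [angle_nonneg (x - axisPoint n (-r)) (axisPoint n r - x)]

theorem disjoint_cap₁_curveT (hr : 0 < r) (hσ₁ : 0 < σ₁) (hσ₂ : 0 < σ₂) (hL : 0 < L) :
    Disjoint (cap₁ n r σ₁ σ₂ L) (curveT n r σ₁ σ₂ L) := by
  rw [Set.disjoint_left]
  intro x h h'
  exact ((mem_cap₁_iff hr hσ₁ hσ₂ hL).1 h).2.2.ne' ((mem_curveT_iff hr hσ₁ hσ₂ hL).1 h').2

theorem disjoint_cap₂_curveT (hr : 0 < r) (hσ₁ : 0 < σ₁) (hσ₂ : 0 < σ₂) (hL : 0 < L) :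
    Disjoint (cap₂ n r σ₁ σ₂ L) (curveT n r σ₁ σ₂ L) := by
  rw [Set.disjoint_left]
  intro x h h'
  exact ((mem_cap₂_iff hr hσ₁ hσ₂ hL).1 h).2.2.ne' ((mem_curveT_iff hr hσ₁ hσ₂ hL).1 h').2

theorem mem_frontier_solutionRegion_iff (hr : 0 < r) (hσ₁ : 0 < σ₁) (hσ₂ : 0 < σ₂) (hL : 0 < L)
    {x : E n} :
    x ∈ frontier (solutionRegion (axisPoint n (-r)) (axisPoint n r) σ₁ σ₂ L) ↔
      x ∈ cap₁ n r σ₁ σ₂ L ∨ x ∈ cap₂ n r σ₁ σ₂ L ∨ x ∈ curveT n r σ₁ σ₂ L ∨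
      (x = axisPoint n (-r) ∧ 2 * r ≤ L / σ₂) ∨ (x = axisPoint n r ∧ 2 * r ≤ L / σ₁) := by
  have hc := axisPoint_neg_ne (n := n) hr
  rw [frontier_solutionRegion_eq_outerRegion hc hσ₁ hσ₂ hL,
    mem_frontier_outerRegion_iff hc hσ₁ hσ₂ hL, mem_cap₁_iff hr hσ₁ hσ₂ hL,
    mem_cap₂_iff hr hσ₁ hσ₂ hL, mem_curveT_iff hr hσ₁ hσ₂ hL, norm_center_sub_center hr]

theorem cap₁_eq_empty (hr : 0 < r) (hσ₁ : 0 < σ₁) (hσ₂ : 0 < σ₂) (hL : 0 < L)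
    (h : 2 * r ≤ L / σ₁) : cap₁ n r σ₁ σ₂ L = ∅ := by
  refine Set.eq_empty_of_forall_notMem fun x hx => ?_
  obtain ⟨d, hx⟩ := (mem_cap₁_iff hr hσ₁ hσ₂ hL).1 hx
  exact not_angleGap_pos_on_sphere (axisPoint_neg_ne hr) hσ₁ hσ₂ hL
    ((norm_center_sub_center hr).trans_le h) d hx

theorem cap₂_eq_empty (hr : 0 < r) (hσ₁ : 0 < σ₁) (hσ₂ : 0 < σ₂) (hL : 0 < L)
    (h : 2 * r ≤ L / σ₂) : cap₂ n r σ₁ σ₂ L = ∅ := by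
  refine Set.eq_empty_of_forall_notMem fun x hx => ?_
  obtain ⟨d, hx⟩ := (mem_cap₂_iff hr hσ₁ hσ₂ hL).1 hx
  exact not_angleGap_pos_on_second_sphere (axisPoint_neg_ne hr) hσ₁ hσ₂ hL
    ((norm_center_sub_center hr).trans_le h) d hx

theorem solutionRegion_eq_singleton (hr : 0 < r) (hσ₁ : 0 < σ₁) (hσ₂ : 0 < σ₂) (hL : 0 < L)
    (h : r = L / 2 * (1 / σ₁ + 1 / σ₂)) :
    solutionRegion (axisPoint n (-r)) (axisPoint n r) σ₁ σ₂ L =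
      {axisPoint n (L / 2 * (1 / σ₁ - 1 / σ₂))} := by
  have hc := axisPoint_neg_ne (n := n) hr
  have hR₁ : 0 < L / σ₁ := div_pos hL hσ₁
  have hR₂ : 0 < L / σ₂ := div_pos hL hσ₂
  have e1 : r = (L / σ₁ + L / σ₂) / 2 := by rw [h]; ring
  have e2 : L / 2 * (1 / σ₁ - 1 / σ₂) = (L / σ₁ - L / σ₂) / 2 := by ring
  rw [e2]
  refine Set.Subset.antisymm (fun x hx => ?_) (Set.singleton_subset_iff.2 ?_)
  · obtain ⟨d1, d2⟩ := norm_sub_le_of_mem_solutionRegion hc hσ₁ hσ₂ hL hx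
    have s1 := pow_le_pow_left₀ (norm_nonneg _) d1 2
    have s2 := pow_le_pow_left₀ (norm_nonneg _) d2 2
    have s3 := norm_sub_axisPoint_sq x ((L / σ₁ - L / σ₂) / 2)
    rw [norm_sub_axisPoint_sq] at s1 s2
    rw [Set.mem_singleton_iff, ← sub_eq_zero, ← norm_eq_zero, ← sq_eq_zero_iff]
    refine le_antisymm ?_ (sq_nonneg _)
    rw [s3]
    generalize L / σ₁ = p at *
    generalize L / σ₂ = q at *
    subst e1
    -- Stewart's identity: weighting the two ball inequalities by the opposite radii sums to `(p +
    -- q)` times the squared distance to the tangency point being at most `0`.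
    have m1 := mul_le_mul_of_nonneg_left s1 hR₂.le
    have m2 := mul_le_mul_of_nonneg_left s2 hR₁.le
    refine nonpos_of_mul_nonpos_right ?_ (add_pos hR₁ hR₂)
    linarith
  · refine innerRegion_subset_solutionRegion hc hσ₁ hσ₂ hL (Or.inr ⟨?_, ?_, ?_⟩)
    · rw [norm_center_sub_center hr, e1]; ring
    · rw [norm_axisPoint_sub_axisPoint, e1, abs_of_pos] <;> linarith
    · rw [norm_axisPoint_sub_axisPoint, e1, abs_of_neg] <;> linarith

theorem solutionRegion_eq_empty (hr : 0 < r) (hσ₁ : 0 < σ₁) (hσ₂ : 0 < σ₂) (hL : 0 < L)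
    (h : L / 2 * (1 / σ₁ + 1 / σ₂) < r) :
    solutionRegion (axisPoint n (-r)) (axisPoint n r) σ₁ σ₂ L = ∅ := by
  refine Set.eq_empty_of_forall_notMem fun x hx => ?_
  obtain ⟨d1, d2⟩ := norm_sub_le_of_mem_solutionRegion (axisPoint_neg_ne hr) hσ₁ hσ₂ hL hx
  have t := norm_sub_le_norm_sub_add_norm_sub (axisPoint n r) x (axisPoint n (-r))
  rw [norm_center_sub_center hr, norm_sub_rev _ x] at t
  have : L / 2 * (1 / σ₁ + 1 / σ₂) = (L / σ₁ + L / σ₂) / 2 := by ring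
  linarith

end Coordinates

end PotentialRegion

theorem mainTheorem1 {n : ℕ} [NeZero n] (σ₁ σ₂ L : ℝ)
    (hσ₁ : 0 < σ₁) (hσ₂ : 0 < σ₂) (hL : 0 < L) :
    (∀ c₁ c₂ : PotentialRegion.E n, c₁ ≠ c₂ →
      frontier (PotentialRegion.solutionRegion c₁ c₂ σ₁ σ₂ L) =
          frontier (PotentialRegion.outerRegion c₁ c₂ σ₁ σ₂ L) ∧
        frontier (PotentialRegion.outerRegion c₁ c₂ σ₁ σ₂ L) =
          frontier (PotentialRegion.innerRegion c₁ c₂ σ₁ σ₂ L)) ∧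
    (σ₂ ≤ σ₁ → ∀ r : ℝ, 0 < r →
      ∀ c₁ c₂ : PotentialRegion.E n,
      c₁ = PotentialRegion.axisPoint n (-r) → c₂ = PotentialRegion.axisPoint n r →
      -- first case: one hypersurface and both centres
      (r ≤ L / (2 * σ₁) →
        frontier (PotentialRegion.solutionRegion c₁ c₂ σ₁ σ₂ L) =
            PotentialRegion.curveT n r σ₁ σ₂ L ∪ {c₁, c₂} ∧
          Disjoint (PotentialRegion.curveT n r σ₁ σ₂ L) {c₁, c₂}) ∧
      -- second case: two hypersurfaces and the first centre
      (L / (2 * σ₁) < r → r ≤ L / (2 * σ₂) →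
        frontier (PotentialRegion.solutionRegion c₁ c₂ σ₁ σ₂ L) =
            PotentialRegion.cap₁ n r σ₁ σ₂ L ∪ PotentialRegion.curveT n r σ₁ σ₂ L ∪ {c₁} ∧
          Disjoint (PotentialRegion.cap₁ n r σ₁ σ₂ L) (PotentialRegion.curveT n r σ₁ σ₂ L) ∧
          Disjoint (PotentialRegion.cap₁ n r σ₁ σ₂ L ∪ PotentialRegion.curveT n r σ₁ σ₂ L)
            {c₁}) ∧
      -- third case: three hypersurfaces
      (L / (2 * σ₂) < r → r < L / 2 * (1 / σ₁ + 1 / σ₂) →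
        frontier (PotentialRegion.solutionRegion c₁ c₂ σ₁ σ₂ L) =
            PotentialRegion.cap₁ n r σ₁ σ₂ L ∪ PotentialRegion.cap₂ n r σ₁ σ₂ L ∪
              PotentialRegion.curveT n r σ₁ σ₂ L ∧
          Disjoint (PotentialRegion.cap₁ n r σ₁ σ₂ L) (PotentialRegion.cap₂ n r σ₁ σ₂ L) ∧
          Disjoint (PotentialRegion.cap₁ n r σ₁ σ₂ L ∪ PotentialRegion.cap₂ n r σ₁ σ₂ L)
            (PotentialRegion.curveT n r σ₁ σ₂ L)) ∧
      -- fourth case: a single point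
      (r = L / 2 * (1 / σ₁ + 1 / σ₂) →
        PotentialRegion.solutionRegion c₁ c₂ σ₁ σ₂ L =
          {PotentialRegion.axisPoint n (L / 2 * (1 / σ₁ - 1 / σ₂))}) ∧
      -- fifth case: the empty set
      (L / 2 * (1 / σ₁ + 1 / σ₂) < r →
        PotentialRegion.solutionRegion c₁ c₂ σ₁ σ₂ L = ∅)) := by
  open PotentialRegion in
  refine ⟨fun c₁ c₂ hc => ⟨frontier_solutionRegion_eq_outerRegion hc hσ₁ hσ₂ hL,
    (frontier_innerRegion_eq_outerRegion hc hσ₁ hσ₂ hL).symm⟩, ?_⟩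
  rintro hσ r hr _ _ rfl rfl
  -- The ordering of the radii makes the first threshold imply the second in case one, and rules out
  -- both centres in case three.
  have hR : L / σ₁ ≤ L / σ₂ := by gcongr
  have e1 : L / (2 * σ₁) = L / σ₁ / 2 := by rw [mul_comm, div_div]
  have e2 : L / (2 * σ₂) = L / σ₂ / 2 := by rw [mul_comm, div_div]
  have hdom : ∀ x ∈ curveT n r σ₁ σ₂ L, x ≠ axisPoint n (-r) ∧ x ≠ axisPoint n r :=
    fun x hx => (mem_angleDomain_iff.1 hx.1).2
  rw [e1, e2]
  refine ⟨fun h => ⟨?_, ?_⟩, fun h h' => ⟨?_, disjoint_cap₁_curveT hr hσ₁ hσ₂ hL, ?_⟩,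
    fun h h' => ⟨?_, disjoint_cap₁_cap₂ hr hσ₁ hσ₂ hL,
      (disjoint_cap₁_curveT hr hσ₁ hσ₂ hL).union_left (disjoint_cap₂_curveT hr hσ₁ hσ₂ hL)⟩,
    solutionRegion_eq_singleton hr hσ₁ hσ₂ hL, solutionRegion_eq_empty hr hσ₁ hσ₂ hL⟩
  · ext x
    have h1 : 2 * r ≤ L / σ₁ := by linarith
    have h2 : 2 * r ≤ L / σ₂ := by linarith
    rw [mem_frontier_solutionRegion_iff hr hσ₁ hσ₂ hL, cap₁_eq_empty hr hσ₁ hσ₂ hL h1,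
      cap₂_eq_empty hr hσ₁ hσ₂ hL h2]
    simp [h1, h2]
    tauto
  · rw [Set.disjoint_left]
    rintro x hx (h0 | h0)
    · exact (hdom x hx).1 h0
    · exact (hdom x hx).2 h0
  · ext x
    have h1 : ¬ 2 * r ≤ L / σ₁ := by linarith
    have h2 : 2 * r ≤ L / σ₂ := by linarith
    rw [mem_frontier_solutionRegion_iff hr hσ₁ hσ₂ hL, cap₂_eq_empty hr hσ₁ hσ₂ hL h2]
    simp [h1, h2]
    tauto
  · rw [Set.disjoint_singleton_right]
    rintro (h0 | h0)
    · exact (mem_angleDomain_iff.1 ((mem_cap₁_iff hr hσ₁ hσ₂ hL).1 h0).2.1).2.1 rfl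
    · exact (hdom _ h0).1 rfl
  · ext x
    have h1 : ¬ 2 * r ≤ L / σ₁ := by linarith
    have h2 : ¬ 2 * r ≤ L / σ₂ := by linarith
    rw [mem_frontier_solutionRegion_iff hr hσ₁ hσ₂ hL]
    simp [h1, h2]
    tauto
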